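/- \textbf{Setting.} Fix $N\in\mathbb{N}$, $\alpha\in(0,1)$ and bond returns $\mathfrak r_1,\dots,\mathfrak r_N\in[1,\infty)$; put $B_N=\mathfrak r_1\cdots\mathfrak r_N$, $u_\alpha(y)=y^\alpha$ and $\psi(x)=1+u_\alpha(x)$ for $x,y\ge 0$. The state space is $[0,\infty)$, and in state $x$ the admissible actions at every time are $a\in[0,x]$; let $D=\{(x,a):x\ge0,\ a\in[0,x]\}$. Let $\mathcal M_1^\alpha$ be the set of Borel probability measures $\mu$ on $[0,\infty)$ with $\int u_\alpha\,d\mu<\infty$, and let $\mathcal P_\psi$ be the set of all transition functions $\boldsymbol P=(P_0,\dots,P_{N-1})$ of the form $$P_n((x,a),\cdot)=\mathfrak m^{\boldsymbol P}_{n+1}\circ\eta_{n,(x,a)}^{-1},\qquad \eta_{n,(x,a)}(y)=\mathfrak r_{n+1}x+a(y-\mathfrak r_{n+1}),\qquad (x,a)\in D,$$ with $\mathfrak m^{\boldsymbol P}_1,\dots,\mathfrak m^{\boldsymbol P}_N\in\mathcal M_1^\alpha$. A strategy is a tuple $\pi=(f_0,\dots,f_{N-1})$ of Borel functions with $f_n(x)\in[0,x]$.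 Let $\mathbb P^{x_0,\boldsymbol P;\pi}=\delta_{x_0}\otimes P_0^\pi\otimes\cdots\otimes P_{N-1}^\pi$, where $P_n^\pi(x,\cdot)=P_n((x,f_n(x)),\cdot)$, be the law of the wealth process $(X_0,\dots,X_N)$, and set $$\mathcal V_0^{x_0;\pi}(\boldsymbol P)=\mathbb E^{x_0,\boldsymbol P;\pi}[u_\alpha(X_N/B_N)],\qquad \mathcal V_0^{x_0}(\boldsymbol P)=\sup_\pi\mathcal V_0^{x_0;\pi}(\boldsymbol P).$$ A strategy is optimal w.r.t. $\boldsymbol P$ if it attains this supremum for every $x_0\ge 0$. For $\boldsymbol\gamma\in[0,1]^N$ let $\pi_{\boldsymbol\gamma}$ be the linear strategy $f_n(x)=\gamma_n x$; let $\Pi_{\rm lin}(\boldsymbol P)$ be the set of linear strategies that are optimal w.r.t. $\boldsymbol P$. For $\gamma\in[0,1]$ put $v_n^{\boldsymbol P;\gamma}=\int u_\alpha\big(1+\gamma(y/\mathfrak r_{n+1}-1)\big)\,\mathfrak m^{\boldsymbol P}_{n+1}(dy)$, and $v_n^{\boldsymbol P;\boldsymbol\gamma}=v_n^{\boldsymbol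 P;\gamma_n}$. The set $\mathcal P_\psi$ carries the distance $$d(\boldsymbol P,\boldsymbol Q)=\max_{n}\sup_{(x,a)\in D}\frac1{\psi(x)}\sup_{h}\Big|\int h\,dP_n((x,a),\cdot)-\int h\,dQ_n((x,a),\cdot)\Big|,$$ where $h$ ranges over the functions on $[0,\infty)$ with $|h(x)-h(y)|\le|x-y|^\alpha$ for all $x,y$. A functional $\mathcal V:\mathcal P_\psi\to\mathbb R$ is called `Fréchet differentiable' (resp. `Hadamard differentiable') at $\boldsymbol P$ with `derivative' $\dot{\mathcal V}_{\boldsymbol P}:\{\boldsymbol Q-\boldsymbol P:\boldsymbol Q\in\mathcal P_\psi\}\to\mathbb R$ if $\boldsymbol Q\mapsto\dot{\mathcal V}_{\boldsymbol P}(\boldsymbol Q-\boldsymbol P)$ is $d$-continuous on $\mathcal P_\psi$ and if, for every sequence $\varepsilon_m\in(0,1]$ with $\varepsilon_m\to0$, $$\frac{\mathcal V(\boldsymbol P+\varepsilon_m(\boldsymbol Q-\boldsymbol P))-\mathcal V(\boldsymbol P)}{\varepsilon_m}\longrightarrow\dot{\mathcal V}_{\boldsymbol P}(\boldsymbol Q-\boldsymbol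 P)$$ uniformly in $\boldsymbol Q\in\mathcal K$ for every $d$-bounded (resp. relatively $d$-compact) set $\mathcal K\subseteq\mathcal P_\psi$. \textbf{Theorem 3.} Let $\boldsymbol P\in\mathcal P_\psi$ and $x_0\ge0$. The expectations and suprema defining $\mathcal V_0^{x_0;\pi}$ and $\mathcal V_0^{x_0}$ on $\mathcal P_\psi$ are finite, and the following assertions hold. (i) For every $\boldsymbol\gamma\in[0,1]^N$ the map $\mathcal V_0^{x_0;\pi_{\boldsymbol\gamma}}$ is `Fréchet differentiable' at $\boldsymbol P$ with `Fréchet derivative' $$\dot{\mathcal V}_{0;\boldsymbol P}^{x_0;\pi_{\boldsymbol\gamma}}(\boldsymbol Q-\boldsymbol P)=u_\alpha(x_0)\sum_{k=0}^{N-1}v_{N-1}^{\boldsymbol P;\boldsymbol\gamma}\cdots\big(v_k^{\boldsymbol Q;\boldsymbol\gamma}-v_k^{\boldsymbol P;\boldsymbol\gamma}\big)\cdots v_0^{\boldsymbol P;\boldsymbol\gamma},\qquad\boldsymbol Q\in\mathcal P_\psi.$$ (ii) The map $\mathcal V_0^{x_0}$ is `Hadamard differentiable' at $\boldsymbol P$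 with `Hadamard derivative' $$\dot{\mathcal V}_{0;\boldsymbol P}^{x_0}(\boldsymbol Q-\boldsymbol P)=\sup_{\pi\in\Pi_{\rm lin}(\boldsymbol P)}\dot{\mathcal V}_{0;\boldsymbol P}^{x_0;\pi}(\boldsymbol Q-\boldsymbol P),\qquad\boldsymbol Q\in\mathcal P_\psi.$$ If moreover $\mathfrak m^{\boldsymbol P}_{n+1}\neq\delta_{\mathfrak r_{n+1}}$ for every $n=0,\dots,N-1$ (in particular, if $\mathfrak m^{\boldsymbol P}_{n+1}(\{\mathfrak r_{n+1}\})=0$ for every $n$), then for every $n$ the map $\gamma\mapsto v_n^{\boldsymbol P;\gamma}$ has a unique maximizer $\gamma_n^{\boldsymbol P}\in[0,1]$, and with $\boldsymbol\gamma^{\boldsymbol P}=(\gamma_0^{\boldsymbol P},\dots,\gamma_{N-1}^{\boldsymbol P})$ this derivative equals $\dot{\mathcal V}_{0;\boldsymbol P}^{x_0;\pi_{\boldsymbol\gamma^{\boldsymbol P}}}(\boldsymbol Q-\boldsymbol P)$ for every $\boldsymbol Q\in\mathcal P_\psi$. -/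

import Mathlib

open MeasureTheory ProbabilityTheory Filter Topology
open scoped ENNReal NNReal unitInterval

noncomputable section

namespace MDM

/-! ### Finite horizon Markov decision models -/

/-- The data of a Markov decision model with horizon `N`, state space `E` and actions in `A`,
except for the transition function: the sets `A_n(x)` of admissible actions, the one-stage
rewards `r_n : D_n → ℝ` and the terminal reward `r_N : E → ℝ`. -/
structure Model (E A : Type*) [MeasurableSpace E] [MeasurableSpace A] (N : ℕ) where
  /-- the set `A_n(x)` of admissible actions at time `n` in state `x` -/
  actions : Fin N → E → Set A
  /-- there is at least one decision rule at each time -/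
  exists_rule : ∀ n, ∃ f : E → A, Measurable f ∧ ∀ x, f x ∈ actions n x
  /-- the one-stage reward functions, defined on the admissible state-action pairs -/
  reward : (n : Fin N) → {p : E × A // p.2 ∈ actions n p.1} → ℝ
  measurable_reward : ∀ n, Measurable (reward n)
  /-- the terminal reward function -/
  terminal : E → ℝ
  measurable_terminal : Measurable terminal

variable {E A : Type*} [MeasurableSpace E] [MeasurableSpace A] {N : ℕ}

/-- The set `D_n` of admissible state-action pairs at time `n`, with the trace σ-algebra. -/
abbrev Model.D (𝔐 : Model E A N) (n : Fin N) : Type _ :=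
  {p : E × A // p.2 ∈ 𝔐.actions n p.1}

/-- Transition functions: `N`-tuples of probability kernels `P_n` from `D_n` to `E`. -/
@[ext]
structure Transition (𝔐 : Model E A N) where
  kernel : (n : Fin N) → Kernel (𝔐.D n) E
  markov : ∀ n, IsMarkovKernel (kernel n)

/-- Strategies: `N`-tuples of decision rules, i.e. of measurable maps `f_n : E → A` with
`f_n(x) ∈ A_n(x)`. Every strategy is admissible. -/
structure Strategy (𝔐 : Model E A N) where
  rule : Fin N → E → A
  measurable_rule : ∀ n, Measurable (rule n)
  rule_mem : ∀ n x, rule n x ∈ 𝔐.actions n x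

variable {𝔐 : Model E A N}

/-- The state-action pair `(x, f_n(x))`. -/
def Strategy.pair (π : Strategy 𝔐) (n : Fin N) (x : E) : 𝔐.D n :=
  ⟨(x, π.rule n x), π.rule_mem n x⟩

theorem Strategy.measurable_pair (π : Strategy 𝔐) (n : Fin N) : Measurable (π.pair n) :=
  (measurable_id.prodMk (π.measurable_rule n)).subtype_mk

/-- The kernel `P_n^π(x, ·) = P_n((x, f_n(x)), ·)` from `E` to `E`. -/
def Transition.under (P : Transition 𝔐) (π : Strategy 𝔐) (n : Fin N) : Kernel E E :=
  (P.kernel n).comap (π.pair n) (π.measurable_pair n)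

/-- The product `δ_{x₀} ⊗ κ_0 ⊗ ⋯ ⊗ κ_{N-1}` on `E^{N+1}`, for kernels `κ_n` from `E` to `E`. -/
def pathLaw : (N : ℕ) → (Fin N → Kernel E E) → E → Measure (Fin (N + 1) → E)
  | 0, _, x₀ => Measure.dirac fun _ => x₀
  | N + 1, κ, x₀ =>
      ((pathLaw N (fun n => κ n.castSucc) x₀) ⊗ₘ
        ((κ (Fin.last N)).comap (fun ω : Fin (N + 1) → E => ω (Fin.last N))
          (measurable_pi_apply _))).map
        fun p => (Fin.snoc (α := fun _ => E) p.1 p.2 : Fin (N + 2) → E)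

/-- The law of the Markov decision process with initial state `x₀`, transition function `P`
and strategy `π`. -/
def law (P : Transition 𝔐) (π : Strategy 𝔐) (x₀ : E) : Measure (Fin (N + 1) → E) :=
  pathLaw N (P.under π) x₀

/-- The total reward `∑_{k<N} r_k(x_k, f_k(x_k)) + r_N(x_N)` along a path. -/
def totalReward (π : Strategy 𝔐) (ω : Fin (N + 1) → E) : ℝ :=
  ∑ k : Fin N, 𝔐.reward k (π.pair k (ω k.castSucc)) + 𝔐.terminal (ω (Fin.last N))

/-- The expected total reward `V_0^{P;π}(x₀)`. -/
def value (x₀ : E) (π : Strategy 𝔐) (P : Transition 𝔐) : ℝ :=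
  ∫ ω, totalReward π ω ∂(law P π x₀)

/-- The value function `V_0^P(x₀) = sup_π V_0^{P;π}(x₀)`. -/
def optimalValue (x₀ : E) (P : Transition 𝔐) : ℝ :=
  ⨆ π : Strategy 𝔐, value x₀ π P

/-- Optimality of a strategy with respect to `P` (for all initial states). -/
def IsOptimal (P : Transition 𝔐) (π : Strategy 𝔐) : Prop :=
  ∀ x₀, value x₀ π P = optimalValue x₀ P

/-! ### Distances between transition functions -/

/-- The integral probability metric `d_M(μ,ν) = sup_{h ∈ M} |∫ h dμ - ∫ h dν|`. -/
def probDist (M : Set (E → ℝ)) (μ ν : Measure E) : ℝ≥0∞ :=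
  ⨆ h ∈ M, ENNReal.ofReal |∫ x, h x ∂μ - ∫ x, h x ∂ν|

/-- The distance
`d^φ_{∞,M}(P,Q) = max_n sup_{(x,a) ∈ D_n} d_M(P_n((x,a),·), Q_n((x,a),·)) / φ(x)`. -/
def transDist (M : Set (E → ℝ)) (φ : E → ℝ) (P Q : Transition 𝔐) : ℝ≥0∞ :=
  ⨆ n : Fin N, ⨆ d : 𝔐.D n,
    probDist M (P.kernel n d) (Q.kernel n d) / ENNReal.ofReal (φ d.1.1)

/-! ### 'Differentiability' of functionals of the transition function -/

/-- `N`-tuples of maps from `D_n` to the signed measures on `E`. -/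
abbrev SignedTransition (𝔐 : Model E A N) : Type _ :=
  (n : Fin N) → 𝔐.D n → SignedMeasure E

/-- The signed transition function `Q - P`. -/
def diff (Q P : Transition 𝔐) : SignedTransition 𝔐 := fun n d =>
  haveI := Q.markov n
  haveI := P.markov n
  (Q.kernel n d).toSignedMeasure - (P.kernel n d).toSignedMeasure

/-- The mixture `P + ε (Q - P) = (1 - ε) P + ε Q`, for `ε ∈ [0,1]`. -/
def mix (P Q : Transition 𝔐) (ε : I) : Transition 𝔐 where
  kernel n :=
    { toFun := fun d =>
        ENNReal.ofReal (1 - (ε : ℝ)) • P.kernel n d + ENNReal.ofReal (ε : ℝ) • Q.kernel n d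
      measurable' := by
        refine Measure.measurable_of_measurable_coe _ fun s hs => ?_
        simp only [Measure.add_apply, Measure.smul_apply, smul_eq_mul]
        exact ((Kernel.measurable_coe _ hs).const_mul _).add
          ((Kernel.measurable_coe _ hs).const_mul _) }
  markov n := by
    refine ⟨fun d => ⟨?_⟩⟩
    have := P.markov n
    have := Q.markov n
    change (ENNReal.ofReal (1 - (ε : ℝ)) • P.kernel n d
      + ENNReal.ofReal (ε : ℝ) • Q.kernel n d) Set.univ = 1
    simp only [Measure.add_apply, Measure.smul_apply, smul_eq_mul, measure_univ, mul_one]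
    rw [← ENNReal.ofReal_add (by linarith [ε.2.2]) ε.2.1]
    simp

section Differentiability

variable {L : Type*} [NormedAddCommGroup L] [NormedSpace ℝ L]

/-- `(M,φ)`-continuity of a map `W` on the 'tangent space' `{Q - P : Q ∈ T}`: the map
`Q ↦ W(Q - P)` is continuous on `T` with respect to `d^φ_{∞,M}`. -/
def IsContinuousDirection (T : Set (Transition 𝔐)) (M : Set (E → ℝ)) (φ : E → ℝ)
    (P : Transition 𝔐) (W : SignedTransition 𝔐 → L) : Prop :=
  ∀ Q ∈ T, ∀ ε : ℝ, 0 < ε → ∃ δ : ℝ≥0∞, 0 < δ ∧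
    ∀ Q' ∈ T, transDist M φ Q' Q < δ → ‖W (diff Q' P) - W (diff Q P)‖ < ε

/-- `W` is an '`𝒮`-derivative' at `P` with respect to `(M,φ)` of the functional `V` on the
mixture-closed set `T`. Only the values of `V` on `T` and those of `W` on
`{Q - P : Q ∈ T}` matter. -/
def IsSDerivative (T : Set (Transition 𝔐)) (𝒮 : Set (Set (Transition 𝔐)))
    (M : Set (E → ℝ)) (φ : E → ℝ) (V : Transition 𝔐 → L) (P : Transition 𝔐)
    (W : SignedTransition 𝔐 → L) : Prop :=
  IsContinuousDirection T M φ P W ∧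
    ∀ K ∈ 𝒮, ∀ ε : ℕ → I, (∀ m, 0 < ε m) → Tendsto ε atTop (𝓝 0) →
      TendstoUniformlyOn
        (fun m Q => (ε m : ℝ)⁻¹ • (V (mix P Q (ε m)) - V P))
        (fun Q => W (diff Q P)) atTop K

/-- The subsets of `T` that are bounded with respect to `d^φ_{∞,M}`. -/
def boundedSets (T : Set (Transition 𝔐)) (M : Set (E → ℝ)) (φ : E → ℝ) :
    Set (Set (Transition 𝔐)) :=
  {K | K ⊆ T ∧ ∃ P' ∈ T, ∃ δ : ℝ, 0 < δ ∧ ∀ Q ∈ K, transDist M φ Q P' ≤ ENNReal.ofReal δ}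

/-- The subsets of `T` that are relatively compact with respect to `d^φ_{∞,M}`. -/
def relCompactSets (T : Set (Transition 𝔐)) (M : Set (E → ℝ)) (φ : E → ℝ) :
    Set (Set (Transition 𝔐)) :=
  {K | K ⊆ T ∧ ∀ Q : ℕ → Transition 𝔐, (∀ m, Q m ∈ K) →
    ∃ s : ℕ → ℕ, StrictMono s ∧ ∃ Q' ∈ T,
      Tendsto (fun m => transDist M φ (Q (s m)) Q') atTop (𝓝 0)}

/-- `W` is a 'Fréchet derivative' of `V : T → L` at `P` with respect to `(M,φ)`. -/
def IsFrechetDerivative (T : Set (Transition 𝔐)) (M : Set (E → ℝ)) (φ : E → ℝ)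
    (V : Transition 𝔐 → L) (P : Transition 𝔐) (W : SignedTransition 𝔐 → L) : Prop :=
  IsSDerivative T (boundedSets T M φ) M φ V P W

/-- `W` is a 'Hadamard derivative' of `V : T → L` at `P` with respect to `(M,φ)`. -/
def IsHadamardDerivative (T : Set (Transition 𝔐)) (M : Set (E → ℝ)) (φ : E → ℝ)
    (V : Transition 𝔐 → L) (P : Transition 𝔐) (W : SignedTransition 𝔐 → L) : Prop :=
  IsSDerivative T (relCompactSets T M φ) M φ V P W

end Differentiability

/-- The class of functions `h` on a metric space with `‖h‖_{Höl,α} ≤ 1`; it generates the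
Hölder-`α` metric. -/
def holderClass (X : Type*) [MetricSpace X] (α : ℝ) : Set (X → ℝ) :=
  {h | ∀ x y, |h x - h y| ≤ dist x y ^ α}

/-! ### The financial market model

The family `r` holds the bond returns and the family `m` the laws of the asset returns: `r n` and
`m n` (`n = 0, …, N-1`) are the return and the return law over the period from `n` to `n+1`. -/

/-- The power utility `u_α(y) = y ^ α` (used for `y ≥ 0`). -/
def utility (α y : ℝ) : ℝ := y ^ α

/-- The gauge function `ψ = 1 + u_α`. -/
def gauge (α : ℝ) (x : ℝ≥0) : ℝ := 1 + utility α x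

/-- The terminal wealth problem as a decision model: wealth is the state, the amount
`a ∈ [0,x]` invested in the asset is the action, there are no running rewards, and the terminal
reward is `u_α(x / B_N)` with the terminal bond value `B_N = r_1 ⋯ r_N`. -/
def market (α : ℝ) (r : Fin N → ℝ≥0) : Model ℝ≥0 ℝ≥0 N where
  actions _ x := Set.Icc 0 x
  exists_rule _ := ⟨fun _ => 0, measurable_const, fun _ => by simp⟩
  reward _ _ := 0
  measurable_reward _ := measurable_const
  terminal x := utility α ((x / ∏ n, r n : ℝ≥0) : ℝ)
  measurable_terminal := by
    unfold utility
    exact ((measurable_id.div_const _).coe_nnreal_real).pow_const _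

/-- The wealth `η_{(x,a)}(y) = ρ x + a (y - ρ)` after a period with bond return `ρ` and asset
return `y`, when the amount `a` of the wealth `x` is invested in the asset. The expression is
nonnegative for `a ∈ [0,x]`, the only case that is used, so that `toNNReal` changes nothing. -/
def nextWealth (ρ x a y : ℝ≥0) : ℝ≥0 :=
  Real.toNNReal (ρ * x + a * ((y : ℝ) - ρ))

theorem coe_nextWealth (ρ x a y : ℝ≥0) (ha : a ≤ x) :
    (nextWealth ρ x a y : ℝ) = ρ * x + a * ((y : ℝ) - ρ) := by
  refine Real.coe_toNNReal _ ?_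
  have h1 : (0 : ℝ) ≤ ρ * ((x : ℝ) - a) :=
    mul_nonneg ρ.2 (sub_nonneg.2 (by exact_mod_cast ha))
  have h2 : (0 : ℝ) ≤ (a : ℝ) * y := mul_nonneg a.2 y.2
  linarith

/-- The probability measures on `[0,∞)` with `∫ u_α dμ < ∞`. -/
def returnLaws (α : ℝ) : Set (Measure ℝ≥0) :=
  {μ | IsProbabilityMeasure μ ∧ Integrable (fun y : ℝ≥0 => utility α y) μ}

/-- The transition function `P` is generated by the return laws `m`:
`P_n((x,a),·)` is the image of `m_{n+1}` under `η_{n,(x,a)}`. -/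
def IsGeneratedBy (α : ℝ) (r : Fin N → ℝ≥0) (m : Fin N → Measure ℝ≥0)
    (P : Transition (market α r)) : Prop :=
  ∀ (n : Fin N) (d : (market α r).D n),
    P.kernel n d = (m n).map (nextWealth (r n) d.1.1 d.1.2)

/-- The set `𝒫_ψ` of the transition functions that are generated by return laws with finite
`α`-moments. -/
def marketTransitions (α : ℝ) (r : Fin N → ℝ≥0) : Set (Transition (market α r)) :=
  {P | ∃ m : Fin N → Measure ℝ≥0, (∀ n, m n ∈ returnLaws α) ∧ IsGeneratedBy α r m P}

/-- The linear trading strategy `π_γ = (f_n)`, `f_n(x) = γ_n x`. -/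
def linearStrategy (α : ℝ) (r : Fin N → ℝ≥0) (γ : Fin N → I) : Strategy (market α r) where
  rule n x := unitInterval.toNNReal (γ n) * x
  measurable_rule _ := measurable_id.const_mul _
  rule_mem n _ := ⟨zero_le, mul_le_of_le_one_left zero_le (γ n).2.2⟩

/-- The one-stage value `∫ u_α(1 + γ (y / ρ - 1)) μ(dy)`. -/
def oneStage (α : ℝ) (ρ : ℝ≥0) (μ : Measure ℝ≥0) (γ : I) : ℝ :=
  ∫ y : ℝ≥0, utility α (1 + (γ : ℝ) * ((y : ℝ) / ρ - 1)) ∂μ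

/-- The sum `∑_k v_{N-1} ⋯ (w_k - v_k) ⋯ v_0`. -/
def telescopicSum (v w : Fin N → ℝ) : ℝ :=
  ∑ k : Fin N, ∏ j : Fin N, if j = k then w j - v j else v j

end MDM

end

/-!
Investing the proportion `γ` of the wealth multiplies it by `ρ (1 + γ (y / ρ - 1))`, where `ρ` is
the bond return and `y` the asset return. As `u_α` is multiplicative, one period multiplies the
expected utility by `u_α(ρ)` times the one-stage value of `γ`, and an arbitrary strategy does at
most as well as the best proportion (`lintegral_pathLaw_le`, `lintegral_pathLaw_eq`). Hence the
value of `π_γ` is `u_α(x₀)` times the product of the one-stage values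
(`value_linearStrategy`), and the optimal value is the maximum of this over `γ ∈ [0,1]^N`
(`optimalValue_eq`). All expectations are thereby finite.

The one-stage values are affine along mixtures, and they are `2`-Lipschitz in the Hölder metric,
uniformly in `γ`, because `y ↦ u_α(y / ρ)` is one of its test functions (`abs_stage_sub_le`). So
the value of `π_γ` along a mixture is a polynomial in `ε`, whose linear coefficient is the
telescopic sum and whose remainder is `O(ε²)` uniformly in `γ` and over bounded sets of
directions (`exists_abs_linearValue_sub_slope_le`): this is Fréchet differentiability.

For the optimal value, Danskin's theorem (`tendsto_sSup_image_quotient`) on the compact set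
`[0,1]^N` gives the derivative in each single direction as the maximum of the slopes over the
maximizers, which are exactly the optimal linear strategies. The difference quotients are
Lipschitz in the direction up to `O(ε)` (`exists_abs_quotient_sub_le`), so the convergence is
uniform on relatively compact sets: this is Hadamard differentiability. Finally, strict concavity
of `u_α` makes the maximizer of each one-stage value unique unless the asset return equals the
bond return almost surely (`oneStage_midpoint_lt`).
-/

namespace MDM

/-! ### Directional derivatives of suprema -/

theorem sSup_image_le_add {Γ : Type*} {S : Set Γ} (hS : S.Nonempty) {f g : Γ → ℝ} {c : ℝ}
    (hg : BddAbove (g '' S)) (h : ∀ γ ∈ S, f γ ≤ g γ + c) :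
    sSup (f '' S) ≤ sSup (g '' S) + c := by
  refine csSup_le (hS.image f) ?_
  rintro _ ⟨γ, hγ, rfl⟩
  exact (h γ hγ).trans (by gcongr; exact le_csSup hg ⟨γ, hγ, rfl⟩)

theorem abs_sSup_image_sub_le {Γ : Type*} {S : Set Γ} (hS : S.Nonempty) {f g : Γ → ℝ} {c : ℝ}
    (hf : BddAbove (f '' S)) (hg : BddAbove (g '' S)) (h : ∀ γ ∈ S, |f γ - g γ| ≤ c) :
    |sSup (f '' S) - sSup (g '' S)| ≤ c := by
  rw [abs_sub_le_iff]
  constructor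
  · have := sSup_image_le_add hS (f := f) (c := c) hg
      fun γ hγ => by linarith [(abs_le.1 (h γ hγ)).2]
    linarith
  · have := sSup_image_le_add hS (f := g) (c := c) hf
      fun γ hγ => by linarith [(abs_le.1 (h γ hγ)).1]
    linarith

section Danskin

variable {Γ : Type*}

theorem bddAbove_image_of_continuous [TopologicalSpace Γ] [CompactSpace Γ] {f : Γ → ℝ}
    (hf : Continuous f) (S : Set Γ) :
    BddAbove (f '' S) :=
  (isCompact_range hf).bddAbove.mono (Set.image_subset_range f S)

/-- The set of maximizers of `f`. -/
def maximizers (f : Γ → ℝ) : Set Γ := {γ | ∀ γ', f γ' ≤ f γ}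

theorem sSup_image_univ_eq {f : Γ → ℝ} {γ : Γ} (h : γ ∈ maximizers f) :
    sSup (f '' Set.univ) = f γ :=
  IsGreatest.csSup_eq ⟨⟨γ, Set.mem_univ _, rfl⟩, by rintro _ ⟨γ', -, rfl⟩; exact h γ'⟩

variable [TopologicalSpace Γ] [CompactSpace Γ] [Nonempty Γ]

theorem maximizers_nonempty {f : Γ → ℝ} (hf : Continuous f) : (maximizers f).Nonempty := by
  obtain ⟨γ, -, h⟩ := isCompact_univ.exists_isMaxOn Set.univ_nonempty hf.continuousOn
  exact ⟨γ, fun γ' => h (Set.mem_univ γ')⟩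

/-- Danskin's theorem: the directional derivative of the maximum at `f` in direction `g` is the
maximum of `g` over the maximizers of `f`. -/
theorem tendsto_sSup_image_quotient {f g : Γ → ℝ} (hf : Continuous f) (hg : Continuous g)
    {ε : ℕ → ℝ} (hε : ∀ m, 0 < ε m) (hε0 : Tendsto ε atTop (𝓝 0)) :
    Tendsto (fun m => (ε m)⁻¹ *
        (sSup ((fun γ => f γ + ε m * g γ) '' Set.univ) - sSup (f '' Set.univ)))
      atTop (𝓝 (sSup (g '' maximizers f))) := by
  obtain ⟨γ₀, hγ₀⟩ := maximizers_nonempty hf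
  set D := sSup (g '' maximizers f)
  obtain ⟨G, hG⟩ : ∃ G, ∀ γ, |g γ| ≤ G := by
    obtain ⟨G, hG⟩ := (isCompact_range hg.abs).bddAbove
    exact ⟨G, fun γ => hG ⟨γ, rfl⟩⟩
  have hDle : ∀ γ ∈ maximizers f, g γ ≤ D := fun γ hγ =>
    le_csSup (bddAbove_image_of_continuous hg _) ⟨γ, hγ, rfl⟩
  have hcont : ∀ m, Continuous fun γ => f γ + ε m * g γ := fun m => by fun_prop
  have hlow : ∀ m, D ≤ (ε m)⁻¹ *
      (sSup ((fun γ => f γ + ε m * g γ) '' Set.univ) - sSup (f '' Set.univ)) := by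
    intro m
    refine csSup_le ((maximizers_nonempty hf).image g) ?_
    rintro _ ⟨γ, hγ, rfl⟩
    rw [le_inv_mul_iff₀ (hε m), sSup_image_univ_eq hγ]
    have : f γ + ε m * g γ ≤ sSup ((fun γ => f γ + ε m * g γ) '' Set.univ) :=
      le_csSup (bddAbove_image_of_continuous (hcont m) _) ⟨γ, Set.mem_univ _, rfl⟩
    linarith
  rw [Metric.tendsto_atTop']
  intro η hη
  -- away from the region where `g` is close to its maximum over the maximizers, `f` stays below
  -- its maximum by a fixed amount `c`
  obtain ⟨c, hc, hfc⟩ : ∃ c > 0, ∀ γ, D + η / 2 ≤ g γ → f γ ≤ f γ₀ - c := by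
    have hK : IsCompact {γ | D + η / 2 ≤ g γ} := (isClosed_le continuous_const hg).isCompact
    rcases Set.eq_empty_or_nonempty {γ | D + η / 2 ≤ g γ} with he | hne
    · refine ⟨1, one_pos, fun γ hγ => ?_⟩
      have : γ ∈ (∅ : Set Γ) := he ▸ hγ
      exact this.elim
    · obtain ⟨γ₁, h1, hmax⟩ := hK.exists_isMaxOn hne hf.continuousOn
      refine ⟨f γ₀ - f γ₁, ?_, fun γ hγ => by simpa using hmax hγ⟩
      rw [gt_iff_lt, sub_pos]
      by_contra! hle
      have := hDle γ₁ fun γ' => (hγ₀ γ').trans hle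
      simp only [Set.mem_ofPred_eq] at h1
      linarith
  have hG0 : 0 ≤ G := (abs_nonneg _).trans (hG γ₀)
  obtain ⟨M, hM⟩ := (Metric.tendsto_atTop'.1 hε0) (c / (2 * G + 1)) (by positivity)
  refine ⟨M, fun m hm => ?_⟩
  have hεm : ε m * (2 * G + 1) < c := by
    have := hM m hm
    rw [Real.dist_eq, sub_zero, abs_of_pos (hε m), lt_div_iff₀ (by positivity)] at this
    exact this
  have hup : (ε m)⁻¹ *
      (sSup ((fun γ => f γ + ε m * g γ) '' Set.univ) - sSup (f '' Set.univ)) ≤ D + η / 2 := by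
    rw [inv_mul_le_iff₀ (hε m), sSup_image_univ_eq hγ₀, sub_le_iff_le_add]
    refine csSup_le (Set.univ_nonempty.image _) ?_
    rintro _ ⟨γ, -, rfl⟩
    rcases le_or_gt (D + η / 2) (g γ) with h | h
    · have h1 := hfc γ h
      have h2 := (abs_le.1 (hG γ)).2
      have h3 : -G ≤ D := (abs_le.1 (hG γ₀)).1.trans (hDle γ₀ hγ₀)
      have h4 : ε m * g γ ≤ ε m * G := by gcongr; exact (hε m).le
      have h5 : ε m * -G ≤ ε m * (D + η / 2) :=
        mul_le_mul_of_nonneg_left (by linarith) (hε m).le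
      have := hε m
      simp only
      linarith
    · have h1 := hγ₀ γ
      have h4 : ε m * g γ ≤ ε m * (D + η / 2) := by gcongr; exact (hε m).le
      simp only
      linarith
  rw [Real.dist_eq, abs_lt]
  constructor <;> linarith [hlow m]

end Danskin

/-! ### First order expansion of a product -/

theorem telescopicSum_eq {N : ℕ} (v w : Fin N → ℝ) :
    telescopicSum v w = ∑ k, (w k - v k) * ∏ j ∈ Finset.univ.erase k, v j := by
  refine Finset.sum_congr rfl fun k _ => ?_
  rw [← Finset.mul_prod_erase _ _ (Finset.mem_univ k), if_pos rfl]
  congr 1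
  exact Finset.prod_congr rfl fun j hj => if_neg (Finset.ne_of_mem_erase hj)

theorem telescopicSum_succ {N : ℕ} (v w : Fin (N + 1) → ℝ) :
    telescopicSum v w = (w 0 - v 0) * ∏ j : Fin N, v j.succ +
      v 0 * telescopicSum (fun j => v j.succ) (fun j => w j.succ) := by
  simp only [telescopicSum, Fin.sum_univ_succ, Fin.prod_univ_succ, if_true, Fin.succ_ne_zero,
    if_false, Fin.succ_inj, (Fin.succ_ne_zero _).symm, Finset.mul_sum]

theorem abs_prod_le_pow {N : ℕ} {v : Fin N → ℝ} {A : ℝ} (hA : 1 ≤ A) (hv : ∀ n, |v n| ≤ A)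
    (s : Finset (Fin N)) : |∏ n ∈ s, v n| ≤ A ^ N := by
  rw [Finset.abs_prod]
  calc ∏ n ∈ s, |v n| ≤ ∏ _n ∈ s, A :=
        Finset.prod_le_prod (fun _ _ => abs_nonneg _) fun n _ => hv n
    _ = A ^ s.card := by simp
    _ ≤ A ^ N := pow_le_pow_right₀ hA (by simpa using s.card_le_univ)

theorem abs_telescopicSum_sub_le {N : ℕ} {v w w' : Fin N → ℝ} {A t : ℝ} (hA : 1 ≤ A)
    (hv : ∀ n, |v n| ≤ A) (hw : ∀ n, |w n - w' n| ≤ t) :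
    |telescopicSum v w - telescopicSum v w'| ≤ N * A ^ N * t := by
  rw [telescopicSum_eq, telescopicSum_eq, ← Finset.sum_sub_distrib]
  refine (Finset.abs_sum_le_sum_abs _ _).trans ?_
  calc ∑ k, |(w k - v k) * ∏ j ∈ Finset.univ.erase k, v j
          - (w' k - v k) * ∏ j ∈ Finset.univ.erase k, v j|
      ≤ ∑ _k : Fin N, t * A ^ N := by
        refine Finset.sum_le_sum fun k _ => ?_
        rw [← sub_mul, sub_sub_sub_cancel_right, abs_mul]
        exact mul_le_mul (hw k) (abs_prod_le_pow hA hv _) (abs_nonneg _)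
          ((abs_nonneg _).trans (hw k))
    _ = N * A ^ N * t := by simp; ring

theorem telescopicSum_self {N : ℕ} (v : Fin N → ℝ) : telescopicSum v v = 0 := by
  simp [telescopicSum_eq]

theorem abs_telescopicSum_le {N : ℕ} {v w : Fin N → ℝ} {A : ℝ} (hA : 1 ≤ A)
    (hv : ∀ n, |v n| ≤ A) (hw : ∀ n, |w n| ≤ A) :
    |telescopicSum v w| ≤ N * A ^ N * (2 * A) := by
  have := abs_telescopicSum_sub_le (w := w) (w' := v) (t := 2 * A) hA hv fun n => by
    have := abs_sub (w n) (v n)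
    linarith [hv n, hw n]
  simpa [telescopicSum_self] using this

/-- The derivative of a product along a segment is a telescopic sum, with a quadratic error that
is uniform over bounded factors. -/
theorem exists_abs_prod_sub_telescopicSum_le (N : ℕ) {A : ℝ} (hA : 1 ≤ A) :
    ∃ C, 0 ≤ C ∧ ∀ v w : Fin N → ℝ, (∀ n, |v n| ≤ A) → (∀ n, |w n| ≤ A) →
      ∀ ε : ℝ, 0 ≤ ε → ε ≤ 1 →
        |∏ n, ((1 - ε) * v n + ε * w n) - ∏ n, v n - ε * telescopicSum v w| ≤ C * ε ^ 2 := by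
  induction N with
  | zero => exact ⟨0, le_rfl, fun v w _ _ ε _ _ => by simp [telescopicSum]⟩
  | succ N ih =>
    obtain ⟨C, hC0, hC⟩ := ih
    refine ⟨2 * A * (N * A ^ N * (2 * A)) + A * C, by positivity,
      fun v w hv hw ε h0 h1 => ?_⟩
    have hρ := hC (fun j => v j.succ) (fun j => w j.succ) (fun n => hv _) (fun n => hw _) ε h0 h1
    have ht := abs_telescopicSum_le (v := fun j : Fin N => v j.succ)
      (w := fun j : Fin N => w j.succ) hA (fun n => hv _) (fun n => hw _)
    rw [telescopicSum_succ, Fin.prod_univ_succ, Fin.prod_univ_succ]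
    set p := ∏ n : Fin N, v n.succ
    set q := ∏ n : Fin N, ((1 - ε) * v n.succ + ε * w n.succ)
    set t := telescopicSum (fun j : Fin N => v j.succ) (fun j : Fin N => w j.succ)
    have hd : |w 0 - v 0| ≤ 2 * A := by
      have := abs_sub (w 0) (v 0)
      linarith [hv 0, hw 0]
    have hm : |(1 - ε) * v 0 + ε * w 0| ≤ A := by
      refine (abs_add_le _ _).trans ?_
      rw [abs_mul, abs_mul, abs_of_nonneg h0, abs_of_nonneg (sub_nonneg.2 h1)]
      nlinarith [hv 0, hw 0]
    have e : ((1 - ε) * v 0 + ε * w 0) * q - v 0 * p - ε * ((w 0 - v 0) * p + v 0 * t)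
        = (w 0 - v 0) * t * ε ^ 2 + ((1 - ε) * v 0 + ε * w 0) * (q - p - ε * t) := by ring
    rw [e]
    refine (abs_add_le _ _).trans ?_
    rw [abs_mul, abs_mul, abs_mul, abs_of_nonneg (sq_nonneg ε), add_mul, mul_assoc A]
    gcongr

/-! ### The one-stage problem -/

section OneStage

variable {α : ℝ} {ρ : ℝ≥0} {μ : Measure ℝ≥0}

theorem utility_nonneg {y : ℝ} (hy : 0 ≤ y) : 0 ≤ utility α y := Real.rpow_nonneg hy _

theorem measurable_utility_coe (α : ℝ) : Measurable fun y : ℝ≥0 => utility α y :=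
  measurable_coe_nnreal_real.pow_const α

/-- The terminal utility `y ↦ u_α(y / ρ)` is an admissible test function of the
Hölder-`α` metric. -/
theorem utility_div_mem_holderClass (hα0 : 0 < α) (hα1 : α < 1) (hρ : 1 ≤ ρ) :
    (fun y : ℝ≥0 => utility α ((y / ρ : ℝ≥0) : ℝ)) ∈ holderClass ℝ≥0 α := by
  have key : ∀ x y : ℝ≥0, y ≤ x →
      utility α ((x / ρ : ℝ≥0) : ℝ) ≤ utility α ((y / ρ : ℝ≥0) : ℝ) + dist x y ^ α := by
    intro x y hxy
    have hd : dist x y = (x : ℝ) - y := by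
      rw [NNReal.dist_eq, abs_of_nonneg (sub_nonneg.2 (by exact_mod_cast hxy))]
    have hρ' : (1 : ℝ) ≤ ρ := by exact_mod_cast hρ
    have hxy' : (y : ℝ) ≤ x := by exact_mod_cast hxy
    have h1 : ((x / ρ : ℝ≥0) : ℝ) ≤ ((y / ρ : ℝ≥0) : ℝ) + dist x y := by
      rw [hd]
      push_cast
      have : ((x : ℝ) - y) / ρ ≤ (x : ℝ) - y := div_le_self (by linarith) hρ'
      rw [sub_div] at this
      linarith
    calc utility α ((x / ρ : ℝ≥0) : ℝ)
        ≤ (((y / ρ : ℝ≥0) : ℝ) + dist x y) ^ α := Real.rpow_le_rpow (by positivity) h1 hα0.le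
      _ ≤ _ := Real.rpow_add_le_add_rpow (by positivity) dist_nonneg hα0.le hα1.le
  intro x y
  rcases le_total y x with h | h
  · have h2 : utility α ((y / ρ : ℝ≥0) : ℝ) ≤ utility α ((x / ρ : ℝ≥0) : ℝ) :=
      Real.rpow_le_rpow (by positivity) (by exact_mod_cast div_le_div_of_nonneg_right h zero_le)
        hα0.le
    rw [abs_of_nonneg (sub_nonneg.2 h2)]
    linarith [key x y h]
  · have h2 : utility α ((x / ρ : ℝ≥0) : ℝ) ≤ utility α ((y / ρ : ℝ≥0) : ℝ) :=
      Real.rpow_le_rpow (by positivity) (by exact_mod_cast div_le_div_of_nonneg_right h zero_le)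
        hα0.le
    rw [abs_sub_comm, abs_of_nonneg (sub_nonneg.2 h2), dist_comm]
    linarith [key y x h]

theorem growth_nonneg (γ : I) (y : ℝ≥0) : 0 ≤ 1 + (γ : ℝ) * ((y : ℝ) / ρ - 1) := by
  have h1 : 0 ≤ (γ : ℝ) * ((y : ℝ) / ρ) := mul_nonneg γ.2.1 (by positivity)
  have h2 := γ.2.2
  linarith

theorem utility_growth_le (hα0 : 0 < α) (hα1 : α < 1) (hρ : 1 ≤ ρ) (γ : I) (y : ℝ≥0) :
    utility α (1 + (γ : ℝ) * ((y : ℝ) / ρ - 1)) ≤ 1 + utility α y := by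
  have hρ' : (1 : ℝ) ≤ ρ := by exact_mod_cast hρ
  have h0 : (0 : ℝ) ≤ (y : ℝ) / ρ := by positivity
  have h1 : (y : ℝ) / ρ ≤ y := div_le_self y.2 hρ'
  have h2 : 1 + (γ : ℝ) * ((y : ℝ) / ρ - 1) ≤ 1 + y := by
    have := mul_le_of_le_one_left h0 γ.2.2
    have := γ.2.1
    linarith
  refine (Real.rpow_le_rpow (growth_nonneg γ y) h2 hα0.le).trans ?_
  refine (Real.rpow_add_le_add_rpow zero_le_one y.2 hα0.le hα1.le).trans ?_
  rw [Real.one_rpow]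
  rfl

theorem measurable_utility_growth (α : ℝ) (ρ : ℝ≥0) (γ : ℝ) :
    Measurable fun y : ℝ≥0 => utility α (1 + γ * ((y : ℝ) / ρ - 1)) :=
  Measurable.pow_const (f := fun y : ℝ≥0 => 1 + γ * ((y : ℝ) / ρ - 1)) (by fun_prop) α

theorem integrable_utility_growth (hα0 : 0 < α) (hα1 : α < 1) (hρ : 1 ≤ ρ)
    (hμ : μ ∈ returnLaws α) (γ : I) :
    Integrable (fun y : ℝ≥0 => utility α (1 + (γ : ℝ) * ((y : ℝ) / ρ - 1))) μ := by
  have := hμ.1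
  refine ((integrable_const 1).add hμ.2).mono'
    (measurable_utility_growth α ρ γ).aestronglyMeasurable (Eventually.of_forall fun y => ?_)
  rw [Real.norm_of_nonneg (utility_nonneg (growth_nonneg γ y))]
  exact utility_growth_le hα0 hα1 hρ γ y

theorem continuous_oneStage (hα0 : 0 < α) (hα1 : α < 1) (hρ : 1 ≤ ρ) (hμ : μ ∈ returnLaws α) :
    Continuous (oneStage α ρ μ) := by
  have := hμ.1
  refine continuous_of_dominated (bound := fun y : ℝ≥0 => 1 + utility α y)
    (fun γ => (measurable_utility_growth α ρ γ).aestronglyMeasurable)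
    (fun γ => Eventually.of_forall fun y => ?_) ((integrable_const 1).add hμ.2)
    (Eventually.of_forall fun y => ?_)
  · rw [Real.norm_of_nonneg (utility_nonneg (growth_nonneg γ y))]
    exact utility_growth_le hα0 hα1 hρ γ y
  · exact Continuous.rpow_const (by fun_prop) fun _ => Or.inr hα0.le

theorem oneStage_nonneg (γ : I) : 0 ≤ oneStage α ρ μ γ :=
  integral_nonneg fun y => utility_nonneg (growth_nonneg γ y)

theorem oneStage_zero (hμ : μ ∈ returnLaws α) : oneStage α ρ μ 0 = 1 := by
  have := hμ.1
  simp [oneStage, utility]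

theorem exists_isMaxOn_oneStage (hα0 : 0 < α) (hα1 : α < 1) (hρ : 1 ≤ ρ)
    (hμ : μ ∈ returnLaws α) :
    ∃ γ, 1 ≤ oneStage α ρ μ γ ∧ ∀ γ', oneStage α ρ μ γ' ≤ oneStage α ρ μ γ := by
  obtain ⟨γ, -, h⟩ := isCompact_univ.exists_isMaxOn (Set.univ_nonempty (α := I))
    (continuous_oneStage hα0 hα1 hρ hμ).continuousOn
  have h' : ∀ γ', oneStage α ρ μ γ' ≤ oneStage α ρ μ γ := fun γ' => h (Set.mem_univ γ')
  exact ⟨γ, (oneStage_zero hμ).symm.trans_le (h' 0), h'⟩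

theorem oneStage_mix (hα0 : 0 < α) (hα1 : α < 1) (hρ : 1 ≤ ρ) {ν : Measure ℝ≥0}
    (hμ : μ ∈ returnLaws α) (hν : ν ∈ returnLaws α) {ε : ℝ} (h0 : 0 ≤ ε) (h1 : ε ≤ 1) (γ : I) :
    oneStage α ρ (ENNReal.ofReal (1 - ε) • μ + ENNReal.ofReal ε • ν) γ =
      (1 - ε) * oneStage α ρ μ γ + ε * oneStage α ρ ν γ := by
  rw [oneStage, integral_add_measure
    ((integrable_utility_growth hα0 hα1 hρ hμ γ).smul_measure ENNReal.ofReal_ne_top)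
    ((integrable_utility_growth hα0 hα1 hρ hν γ).smul_measure ENNReal.ofReal_ne_top),
    integral_smul_measure, integral_smul_measure, ENNReal.toReal_ofReal h0,
    ENNReal.toReal_ofReal (by linarith)]
  rfl

/-- Unless the asset return is almost surely the bond return, strict concavity of the utility
makes the one-stage value at the midpoint exceed the mean of the values at the end points. -/
theorem oneStage_midpoint_lt (hα0 : 0 < α) (hα1 : α < 1) (hρ : 1 ≤ ρ) (hμ : μ ∈ returnLaws α)
    (hne : μ ≠ Measure.dirac ρ) {γ γ' γm : I} (hγ : γ ≠ γ')
    (hm : (γm : ℝ) = (γ + γ') / 2) :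
    (oneStage α ρ μ γ + oneStage α ρ μ γ') / 2 < oneStage α ρ μ γm := by
  have := hμ.1
  have hi := fun δ : I => integrable_utility_growth hα0 hα1 hρ hμ δ
  set g : ℝ≥0 → ℝ := fun y => utility α (1 + (γm : ℝ) * ((y : ℝ) / ρ - 1)) -
    (utility α (1 + (γ : ℝ) * ((y : ℝ) / ρ - 1)) +
      utility α (1 + (γ' : ℝ) * ((y : ℝ) / ρ - 1))) / 2
  have hmean : Integrable (fun y : ℝ≥0 => (utility α (1 + (γ : ℝ) * ((y : ℝ) / ρ - 1)) +
      utility α (1 + (γ' : ℝ) * ((y : ℝ) / ρ - 1))) / 2) μ :=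
    ((hi γ).add (hi γ')).div_const 2
  have hgi : Integrable g μ := (hi γm).sub hmean
  have hρ0 : (ρ : ℝ) ≠ 0 := by
    have : (1 : ℝ) ≤ ρ := by exact_mod_cast hρ
    linarith
  have hmid : ∀ y : ℝ≥0, 1 + (γm : ℝ) * ((y : ℝ) / ρ - 1) =
      (1 / 2 : ℝ) * (1 + (γ : ℝ) * ((y : ℝ) / ρ - 1))
        + (1 / 2 : ℝ) * (1 + (γ' : ℝ) * ((y : ℝ) / ρ - 1)) := by
    intro y; rw [hm]; ring
  have hpos : ∀ y, y ≠ ρ → 0 < g y := by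
    intro y hy
    have hyρ : (y : ℝ) / ρ - 1 ≠ 0 := by
      rw [sub_ne_zero, Ne, div_eq_one_iff_eq hρ0]
      exact_mod_cast hy
    have hn : 1 + (γ : ℝ) * ((y : ℝ) / ρ - 1) ≠ 1 + (γ' : ℝ) * ((y : ℝ) / ρ - 1) := by
      intro h
      exact hγ (Subtype.ext (mul_right_cancel₀ hyρ (add_left_cancel h)))
    have h := (Real.strictConcaveOn_rpow hα0 hα1).2 (growth_nonneg (ρ := ρ) γ y)
      (growth_nonneg (ρ := ρ) γ' y) hn
      (show (0 : ℝ) < 1 / 2 by norm_num) (show (0 : ℝ) < 1 / 2 by norm_num) (by norm_num)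
    simp only [smul_eq_mul] at h
    rw [← hmid y] at h
    simp only [g, utility]
    linarith
  have hg0 : 0 ≤ g := by
    intro y
    rcases eq_or_ne y ρ with rfl | h
    · simp [g, div_self hρ0, utility]
    · exact (hpos y h).le
  have hsupp : 0 < μ (Function.support g) := by
    rw [pos_iff_ne_zero]
    intro h0
    refine hne ?_
    have hae : (id : ℝ≥0 → ℝ≥0) =ᵐ[μ] fun _ => ρ := by
      refine measure_mono_null (fun y hy => ?_) h0
      exact (hpos y hy).ne'
    rw [← Measure.map_id (μ := μ), Measure.map_congr hae, Measure.map_const]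
    simp
  have hlt := (integral_pos_iff_support_of_nonneg hg0 hgi).2 hsupp
  have heq : ∫ y, g y ∂μ = oneStage α ρ μ γm - (oneStage α ρ μ γ + oneStage α ρ μ γ') / 2 := by
    simp only [g]
    rw [integral_sub (hi γm) hmean, integral_div,
      integral_add (hi γ) (hi γ')]
    rfl
  rw [heq] at hlt
  linarith

theorem exists_unique_max_oneStage (hα0 : 0 < α) (hα1 : α < 1) (hρ : 1 ≤ ρ)
    (hμ : μ ∈ returnLaws α) (hne : μ ≠ Measure.dirac ρ) :
    ∃ γ₀ : I, ∀ γ, γ ≠ γ₀ → oneStage α ρ μ γ < oneStage α ρ μ γ₀ := by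
  obtain ⟨γ₀, -, hmax⟩ := exists_isMaxOn_oneStage hα0 hα1 hρ hμ
  refine ⟨γ₀, fun γ hγ => lt_of_le_of_ne (hmax γ) fun heq => ?_⟩
  have hI : ((γ : ℝ) + γ₀) / 2 ∈ I :=
    ⟨by linarith [γ.2.1, γ₀.2.1], by linarith [γ.2.2, γ₀.2.2]⟩
  have := oneStage_midpoint_lt hα0 hα1 hρ hμ hne (γm := ⟨_, hI⟩) hγ rfl
  linarith [hmax ⟨_, hI⟩]

end OneStage

/-! ### Growth of expected utility along the wealth process -/

section PathLaw

variable {E : Type*} [MeasurableSpace E]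

theorem measurable_snoc_prod (N : ℕ) : Measurable fun p : (Fin (N + 1) → E) × E =>
    (Fin.snoc (α := fun _ => E) p.1 p.2 : Fin (N + 2) → E) := by
  refine measurable_pi_lambda _ fun i => ?_
  induction i using Fin.lastCases with
  | last => simpa using measurable_snd
  | cast i =>
    simpa [Function.comp_def] using
      (measurable_pi_apply (X := fun _ => E) i).comp measurable_fst

instance isProbabilityMeasure_pathLaw : (N : ℕ) → (κ : Fin N → Kernel E E) →
    [∀ n, IsMarkovKernel (κ n)] → (x₀ : E) → IsProbabilityMeasure (pathLaw N κ x₀)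
  | 0, _, _, _ => by rw [pathLaw]; infer_instance
  | N + 1, κ, _, x₀ => by
    have := isProbabilityMeasure_pathLaw N (fun n => κ n.castSucc) x₀
    rw [pathLaw]
    refine Measure.isProbabilityMeasure_map (measurable_snoc_prod N).aemeasurable

theorem lintegral_pathLaw_succ {N : ℕ} (κ : Fin (N + 1) → Kernel E E)
    [∀ n, IsMarkovKernel (κ n)] (x₀ : E) {g : E → ℝ≥0∞} (hg : Measurable g) :
    ∫⁻ ω, g (ω (Fin.last (N + 1))) ∂pathLaw (N + 1) κ x₀ =
      ∫⁻ ω, ∫⁻ y, g y ∂κ (Fin.last N) (ω (Fin.last N))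
        ∂pathLaw N (fun n => κ n.castSucc) x₀ := by
  rw [pathLaw, lintegral_map (by fun_prop) (measurable_snoc_prod N)]
  simp only [Fin.snoc_last]
  rw [Measure.lintegral_compProd (by fun_prop)]
  rfl

/-- If one step of each kernel scales the expectation of `g` by at most a constant factor, then
the expectation of `g` at the end of the path is at most the product of these factors. -/
theorem lintegral_pathLaw_le : ∀ {N : ℕ} (κ : Fin N → Kernel E E) [∀ n, IsMarkovKernel (κ n)]
    (x₀ : E) {g : E → ℝ≥0∞} (_ : Measurable g) (c : Fin N → ℝ≥0∞)
    (_ : ∀ n x, ∫⁻ y, g y ∂κ n x ≤ c n * g x),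
    ∫⁻ ω, g (ω (Fin.last N)) ∂pathLaw N κ x₀ ≤ (∏ n, c n) * g x₀
  | 0, _, _, _, _, hg, _, _ => by
    rw [pathLaw, lintegral_dirac' _ (by fun_prop)]
    simp
  | N + 1, κ, _, x₀, g, hg, c, h => by
    rw [lintegral_pathLaw_succ κ x₀ hg, Fin.prod_univ_castSucc]
    calc _ ≤ ∫⁻ ω, c (Fin.last N) * g (ω (Fin.last N)) ∂pathLaw N (fun n => κ n.castSucc) x₀ :=
          lintegral_mono fun ω => h _ _
      _ = c (Fin.last N) *
          ∫⁻ ω, g (ω (Fin.last N)) ∂pathLaw N (fun n => κ n.castSucc) x₀ :=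
          lintegral_const_mul _ (by fun_prop)
      _ ≤ c (Fin.last N) * ((∏ n : Fin N, c n.castSucc) * g x₀) := by
          gcongr
          exact lintegral_pathLaw_le _ x₀ hg _ fun n x => h n.castSucc x
      _ = _ := by ring

theorem lintegral_pathLaw_eq : ∀ {N : ℕ} (κ : Fin N → Kernel E E) [∀ n, IsMarkovKernel (κ n)]
    (x₀ : E) {g : E → ℝ≥0∞} (_ : Measurable g) (c : Fin N → ℝ≥0∞)
    (_ : ∀ n x, ∫⁻ y, g y ∂κ n x = c n * g x),
    ∫⁻ ω, g (ω (Fin.last N)) ∂pathLaw N κ x₀ = (∏ n, c n) * g x₀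
  | 0, _, _, _, _, hg, _, _ => by
    rw [pathLaw, lintegral_dirac' _ (by fun_prop)]
    simp
  | N + 1, κ, _, x₀, g, hg, c, h => by
    rw [lintegral_pathLaw_succ κ x₀ hg, Fin.prod_univ_castSucc]
    simp only [h]
    rw [lintegral_const_mul _ (by fun_prop),
      lintegral_pathLaw_eq _ x₀ hg (fun n => c n.castSucc) fun n x => h n.castSucc x]
    ring

end PathLaw

/-! ### The value of the terminal wealth problem -/

section Value

variable {N : ℕ} {α : ℝ} {r : Fin N → ℝ≥0} {m : Fin N → Measure ℝ≥0}
  {Q : Transition (market α r)}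

theorem measurable_nextWealth (ρ x a : ℝ≥0) : Measurable (nextWealth ρ x a) := by
  unfold nextWealth
  fun_prop

theorem utility_nextWealth {ρ : ℝ≥0} (hρ : 1 ≤ ρ) (x : ℝ≥0) (γ : I) (y : ℝ≥0) :
    utility α (nextWealth ρ x (unitInterval.toNNReal γ * x) y) =
      utility α ρ * utility α x * utility α (1 + (γ : ℝ) * ((y : ℝ) / ρ - 1)) := by
  have hρ0 : (ρ : ℝ) ≠ 0 := by
    have : (1 : ℝ) ≤ ρ := by exact_mod_cast hρ
    linarith
  have hle : unitInterval.toNNReal γ * x ≤ x := mul_le_of_le_one_left zero_le γ.2.2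
  rw [coe_nextWealth _ _ _ _ hle]
  unfold utility
  rw [← Real.mul_rpow ρ.coe_nonneg x.coe_nonneg,
    ← Real.mul_rpow (mul_nonneg ρ.coe_nonneg x.coe_nonneg) (growth_nonneg γ y)]
  congr 1
  push_cast
  rw [unitInterval.coe_toNNReal]
  field_simp

theorem exists_proportion {x a : ℝ≥0} (h : a ≤ x) :
    ∃ γ : I, a = unitInterval.toNNReal γ * x := by
  rcases eq_or_ne x 0 with rfl | hx
  · exact ⟨0, by simpa using h⟩
  · refine ⟨⟨a / x, by positivity, div_le_one_of_le₀ (by exact_mod_cast h) x.2⟩, ?_⟩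
    apply NNReal.eq
    push_cast
    rw [unitInterval.coe_toNNReal]
    have : (x : ℝ) ≠ 0 := by exact_mod_cast hx
    field_simp

theorem lintegral_utility_nextWealth (hα0 : 0 < α) (hα1 : α < 1) {ρ : ℝ≥0} (hρ : 1 ≤ ρ)
    {μ : Measure ℝ≥0} (hμ : μ ∈ returnLaws α) (x : ℝ≥0) (γ : I) :
    ∫⁻ y : ℝ≥0, ENNReal.ofReal (utility α y)
        ∂(μ.map (nextWealth ρ x (unitInterval.toNNReal γ * x))) =
      ENNReal.ofReal (utility α ρ * oneStage α ρ μ γ) * ENNReal.ofReal (utility α x) := by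
  rw [lintegral_map (measurable_utility_coe α).ennreal_ofReal (measurable_nextWealth _ _ _)]
  simp only [utility_nextWealth hρ]
  have hρ0 : 0 ≤ utility α ρ := utility_nonneg ρ.2
  have hx0 : 0 ≤ utility α x := utility_nonneg x.2
  simp only [ENNReal.ofReal_mul (mul_nonneg hρ0 hx0)]
  rw [lintegral_const_mul _ (measurable_utility_growth α ρ γ).ennreal_ofReal,
    ← ofReal_integral_eq_lintegral_ofReal (integrable_utility_growth hα0 hα1 hρ hμ γ)
      (Eventually.of_forall fun y => utility_nonneg (growth_nonneg γ y)),
    ← ENNReal.ofReal_mul (mul_nonneg hρ0 hx0),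
    ← ENNReal.ofReal_mul (mul_nonneg hρ0 (oneStage_nonneg γ))]
  congr 1
  rw [oneStage]
  ring

theorem isMarkovKernel_under {E A : Type*} [MeasurableSpace E] [MeasurableSpace A]
    {𝔐 : Model E A N} (P : Transition 𝔐) (π : Strategy 𝔐) (n : Fin N) :
    IsMarkovKernel (P.under π n) := by
  have := P.markov n
  unfold Transition.under
  infer_instance

theorem under_apply (hQ : IsGeneratedBy α r m Q) (π : Strategy (market α r)) (n : Fin N)
    (x : ℝ≥0) : Q.under π n x = (m n).map (nextWealth (r n) x (π.rule n x)) := by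
  rw [Transition.under, Kernel.comap_apply, hQ]
  rfl

theorem lintegral_utility_law_le (hα0 : 0 < α) (hα1 : α < 1) (hr : ∀ n, 1 ≤ r n)
    (hm : ∀ n, m n ∈ returnLaws α) (hQ : IsGeneratedBy α r m Q) (x₀ : ℝ≥0)
    (π : Strategy (market α r)) {M : Fin N → ℝ} (hM : ∀ n γ, oneStage α (r n) (m n) γ ≤ M n) :
    ∫⁻ ω, ENNReal.ofReal (utility α (ω (Fin.last N))) ∂law Q π x₀ ≤
      ENNReal.ofReal ((∏ n, utility α (r n) * M n) * utility α x₀) := by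
  have := isMarkovKernel_under Q π
  have hM0 : ∀ n, 0 ≤ utility α (r n) * M n := fun n =>
    mul_nonneg (utility_nonneg (r n).2) ((oneStage_nonneg 0).trans (hM n 0))
  rw [ENNReal.ofReal_mul (Finset.prod_nonneg fun n _ => hM0 n),
    ENNReal.ofReal_prod_of_nonneg fun n _ => hM0 n]
  refine lintegral_pathLaw_le (Q.under π) x₀ (g := fun y => ENNReal.ofReal (utility α y))
    (measurable_utility_coe α).ennreal_ofReal _ fun n x => ?_
  obtain ⟨γ, hγ⟩ := exists_proportion (π.rule_mem n x).2
  rw [under_apply hQ, hγ, lintegral_utility_nextWealth hα0 hα1 (hr n) (hm n)]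
  gcongr
  · exact utility_nonneg (r n).2
  · exact hM n γ

theorem lintegral_utility_law_linear (hα0 : 0 < α) (hα1 : α < 1) (hr : ∀ n, 1 ≤ r n)
    (hm : ∀ n, m n ∈ returnLaws α) (hQ : IsGeneratedBy α r m Q) (x₀ : ℝ≥0) (γ : Fin N → I) :
    ∫⁻ ω, ENNReal.ofReal (utility α (ω (Fin.last N))) ∂law Q (linearStrategy α r γ) x₀ =
      ENNReal.ofReal
        ((∏ n, utility α (r n) * oneStage α (r n) (m n) (γ n)) * utility α x₀) := by
  have := isMarkovKernel_under Q (linearStrategy α r γ)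
  have hM0 : ∀ n, 0 ≤ utility α (r n) * oneStage α (r n) (m n) (γ n) := fun n =>
    mul_nonneg (utility_nonneg (r n).2) (oneStage_nonneg _)
  rw [ENNReal.ofReal_mul (Finset.prod_nonneg fun n _ => hM0 n),
    ENNReal.ofReal_prod_of_nonneg fun n _ => hM0 n]
  refine lintegral_pathLaw_eq (Q.under (linearStrategy α r γ)) x₀
    (g := fun y => ENNReal.ofReal (utility α y))
    (measurable_utility_coe α).ennreal_ofReal _ fun n x => ?_
  rw [under_apply hQ]
  exact lintegral_utility_nextWealth hα0 hα1 (hr n) (hm n) x (γ n)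

theorem totalReward_market (π : Strategy (market α r)) (ω : Fin (N + 1) → ℝ≥0) :
    totalReward π ω = (∏ n, utility α (r n))⁻¹ * utility α (ω (Fin.last N)) := by
  have h1 : totalReward π ω = utility α ((ω (Fin.last N) / ∏ n, r n : ℝ≥0) : ℝ) := by
    simp [totalReward, market]
  rw [h1]
  unfold utility
  push_cast
  rw [Real.div_rpow (NNReal.coe_nonneg _) (Finset.prod_nonneg fun n _ => (r n).coe_nonneg),
    Real.finsetProd_rpow _ _ fun n _ => (r n).coe_nonneg, div_eq_inv_mul]

theorem measurable_utility_last (N : ℕ) (α : ℝ) :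
    Measurable fun ω : Fin (N + 1) → ℝ≥0 => utility α (ω (Fin.last N)) :=
  (measurable_utility_coe α).comp (measurable_pi_apply _)

theorem prod_utility_pos (hr : ∀ n, 1 ≤ r n) : 0 < ∏ n, utility α (r n) :=
  Finset.prod_pos fun n _ => Real.rpow_pos_of_pos
    (zero_lt_one.trans_le (by exact_mod_cast hr n)) _

theorem value_eq_lintegral (x₀ : ℝ≥0) (π : Strategy (market α r)) (Q : Transition (market α r)) :
    value x₀ π Q = (∏ n, utility α (r n))⁻¹ *
      (∫⁻ ω, ENNReal.ofReal (utility α (ω (Fin.last N))) ∂law Q π x₀).toReal := by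
  simp only [value, totalReward_market]
  rw [integral_const_mul, integral_eq_lintegral_of_nonneg_ae
    (Eventually.of_forall fun ω => utility_nonneg (ω _).2)
    (measurable_utility_last N α).aestronglyMeasurable]

theorem exists_oneStage_max (hα0 : 0 < α) (hα1 : α < 1) (hr : ∀ n, 1 ≤ r n)
    (hm : ∀ n, m n ∈ returnLaws α) :
    ∃ γ : Fin N → I, ∀ n γ', oneStage α (r n) (m n) γ' ≤ oneStage α (r n) (m n) (γ n) := by
  choose γ hγ using fun n => exists_isMaxOn_oneStage hα0 hα1 (hr n) (hm n)
  exact ⟨γ, fun n => (hγ n).2⟩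

theorem integrable_totalReward (hα0 : 0 < α) (hα1 : α < 1) (hr : ∀ n, 1 ≤ r n)
    (hm : ∀ n, m n ∈ returnLaws α) (hQ : IsGeneratedBy α r m Q) (x₀ : ℝ≥0)
    (π : Strategy (market α r)) : Integrable (totalReward π) (law Q π x₀) := by
  obtain ⟨γ, hγ⟩ := exists_oneStage_max hα0 hα1 hr hm
  have h : Integrable (fun ω => utility α (ω (Fin.last N))) (law Q π x₀) := by
    refine ⟨(measurable_utility_last N α).aestronglyMeasurable, ?_⟩
    rw [hasFiniteIntegral_iff_ofReal (Eventually.of_forall fun ω => utility_nonneg (ω _).2)]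
    exact (lintegral_utility_law_le hα0 hα1 hr hm hQ x₀ π hγ).trans_lt ENNReal.ofReal_lt_top
  exact (h.const_mul (∏ n, utility α (r n))⁻¹).congr
    (Eventually.of_forall fun ω => (totalReward_market π ω).symm)

theorem value_le (hα0 : 0 < α) (hα1 : α < 1) (hr : ∀ n, 1 ≤ r n)
    (hm : ∀ n, m n ∈ returnLaws α) (hQ : IsGeneratedBy α r m Q) (x₀ : ℝ≥0)
    (π : Strategy (market α r)) {M : Fin N → ℝ} (hM : ∀ n γ, oneStage α (r n) (m n) γ ≤ M n) :
    value x₀ π Q ≤ (∏ n, M n) * utility α x₀ := by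
  rw [value_eq_lintegral, inv_mul_le_iff₀ (prod_utility_pos hr), ← mul_assoc,
    ← Finset.prod_mul_distrib]
  refine ENNReal.toReal_le_of_le_ofReal ?_ (lintegral_utility_law_le hα0 hα1 hr hm hQ x₀ π hM)
  exact mul_nonneg (Finset.prod_nonneg fun n _ => mul_nonneg (utility_nonneg (r n).2)
    ((oneStage_nonneg 0).trans (hM n 0))) (utility_nonneg x₀.2)

theorem value_linearStrategy (hα0 : 0 < α) (hα1 : α < 1) (hr : ∀ n, 1 ≤ r n)
    (hm : ∀ n, m n ∈ returnLaws α) (hQ : IsGeneratedBy α r m Q) (x₀ : ℝ≥0) (γ : Fin N → I) :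
    value x₀ (linearStrategy α r γ) Q =
      (∏ n, oneStage α (r n) (m n) (γ n)) * utility α x₀ := by
  rw [value_eq_lintegral, lintegral_utility_law_linear hα0 hα1 hr hm hQ, ENNReal.toReal_ofReal,
    Finset.prod_mul_distrib, mul_assoc, inv_mul_cancel_left₀ (prod_utility_pos hr).ne']
  exact mul_nonneg (Finset.prod_nonneg fun n _ => mul_nonneg (utility_nonneg (r n).2)
    (oneStage_nonneg _)) (utility_nonneg x₀.2)

theorem bddAbove_value (hα0 : 0 < α) (hα1 : α < 1) (hr : ∀ n, 1 ≤ r n)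
    (hm : ∀ n, m n ∈ returnLaws α) (hQ : IsGeneratedBy α r m Q) (x₀ : ℝ≥0) :
    BddAbove (Set.range fun π : Strategy (market α r) => value x₀ π Q) := by
  obtain ⟨γ, hγ⟩ := exists_oneStage_max hα0 hα1 hr hm
  exact ⟨_, by rintro _ ⟨π, rfl⟩; exact value_le hα0 hα1 hr hm hQ x₀ π hγ⟩

/-- The product of the one-stage values, i.e. the value of the linear strategy `π_γ` at initial
wealth one, as a function of `γ`. -/
noncomputable def linearValue (α : ℝ) (r : Fin N → ℝ≥0) (m : Fin N → Measure ℝ≥0)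
    (γ : Fin N → I) : ℝ :=
  ∏ n, oneStage α (r n) (m n) (γ n)

theorem continuous_linearValue (hα0 : 0 < α) (hα1 : α < 1) (hr : ∀ n, 1 ≤ r n)
    (hm : ∀ n, m n ∈ returnLaws α) : Continuous (linearValue α r m) :=
  continuous_finsetProd _ fun n _ =>
    (continuous_oneStage hα0 hα1 (hr n) (hm n)).comp (continuous_apply n)

theorem mem_maximizers_linearValue {γ : Fin N → I}
    (hγ : ∀ n γ', oneStage α (r n) (m n) γ' ≤ oneStage α (r n) (m n) (γ n)) :
    γ ∈ maximizers (linearValue α r m) := fun γ' =>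
  Finset.prod_le_prod (fun _ _ => oneStage_nonneg _) fun n _ => hγ n (γ' n)

/-- Linear strategies suffice: the best of them attains the supremum over all strategies. -/
theorem optimalValue_eq (hα0 : 0 < α) (hα1 : α < 1) (hr : ∀ n, 1 ≤ r n)
    (hm : ∀ n, m n ∈ returnLaws α) (hQ : IsGeneratedBy α r m Q) (x₀ : ℝ≥0) :
    optimalValue x₀ Q = sSup (linearValue α r m '' Set.univ) * utility α x₀ := by
  obtain ⟨γ, hγ⟩ := exists_oneStage_max hα0 hα1 hr hm
  rw [sSup_image_univ_eq (mem_maximizers_linearValue hγ)]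
  have : Nonempty (Strategy (market α r)) := ⟨linearStrategy α r γ⟩
  refine le_antisymm (ciSup_le fun π => value_le hα0 hα1 hr hm hQ x₀ π hγ) ?_
  rw [linearValue, ← value_linearStrategy hα0 hα1 hr hm hQ]
  exact le_ciSup (bddAbove_value hα0 hα1 hr hm hQ x₀) (linearStrategy α r γ)

theorem isOptimal_linearStrategy_iff (hα0 : 0 < α) (hα1 : α < 1) (hr : ∀ n, 1 ≤ r n)
    (hm : ∀ n, m n ∈ returnLaws α) (hQ : IsGeneratedBy α r m Q) (γ : Fin N → I) :
    IsOptimal Q (linearStrategy α r γ) ↔ γ ∈ maximizers (linearValue α r m) := by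
  constructor
  · intro h γ'
    have h1 := h 1
    rw [optimalValue_eq hα0 hα1 hr hm hQ, value_linearStrategy hα0 hα1 hr hm hQ] at h1
    simp only [utility, NNReal.coe_one, Real.one_rpow, mul_one] at h1
    rw [linearValue, linearValue, h1]
    exact le_csSup (bddAbove_image_of_continuous (continuous_linearValue hα0 hα1 hr hm) _)
      ⟨γ', Set.mem_univ _, rfl⟩
  · intro h x₀
    rw [optimalValue_eq hα0 hα1 hr hm hQ, value_linearStrategy hα0 hα1 hr hm hQ,
      sSup_image_univ_eq h]
    rfl

/-- If each one-stage problem has a unique solution, these make up the only optimal linear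
strategy. -/
theorem maximizers_linearValue_eq_singleton (hm : ∀ n, m n ∈ returnLaws α) {γ : Fin N → I}
    (hγ : ∀ n γ', γ' ≠ γ n → oneStage α (r n) (m n) γ' < oneStage α (r n) (m n) (γ n)) :
    maximizers (linearValue α r m) = {γ} := by
  have hle : ∀ n γ', oneStage α (r n) (m n) γ' ≤ oneStage α (r n) (m n) (γ n) := fun n γ' => by
    rcases eq_or_ne γ' (γ n) with rfl | h
    · exact le_rfl
    · exact (hγ n γ' h).le
  refine Set.eq_singleton_iff_unique_mem.2 ⟨mem_maximizers_linearValue hle, fun γ' h => ?_⟩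
  by_contra hne
  obtain ⟨k, hk⟩ := Function.ne_iff.1 hne
  have hpos : ∀ n, 0 < oneStage α (r n) (m n) (γ n) := fun n =>
    zero_lt_one.trans_le ((oneStage_zero (hm n)).symm.trans_le (hle n 0))
  have h1 := h γ
  rw [linearValue, linearValue, ← Finset.mul_prod_erase _ _ (Finset.mem_univ k),
    ← Finset.mul_prod_erase _ (fun n => oneStage α (r n) (m n) (γ' n)) (Finset.mem_univ k)] at h1
  refine absurd h1 (not_le.2 ?_)
  calc _ ≤ oneStage α (r k) (m k) (γ' k) *
          ∏ n ∈ Finset.univ.erase k, oneStage α (r n) (m n) (γ n) := by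
        gcongr
        · exact oneStage_nonneg _
        · exact fun _ _ => oneStage_nonneg _
        · exact hle _ _
    _ < _ := by
        gcongr
        · exact Finset.prod_pos fun n _ => hpos n
        · exact hγ k _ hk

end Value

/-! ### Dependence of the one-stage values on the transition function -/

section Stage

variable {N : ℕ} {α : ℝ} {r : Fin N → ℝ≥0} {m mP : Fin N → Measure ℝ≥0}
  {P Q Q' : Transition (market α r)}

/-- The one-stage value at time `n` of investing the proportion `γ`, expressed through the
transition function: the state-action pair is `(1, γ)`. -/
noncomputable def stage (Q : Transition (market α r)) (γ : Fin N → I) (n : Fin N) : ℝ :=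
  ∫ y : ℝ≥0, utility α ((y / r n : ℝ≥0) : ℝ)
    ∂Q.kernel n ⟨(1, unitInterval.toNNReal (γ n)), zero_le, (γ n).2.2⟩

theorem stage_eq_oneStage (hr : ∀ n, 1 ≤ r n) (hQ : IsGeneratedBy α r m Q) (γ : Fin N → I)
    (n : Fin N) : stage Q γ n = oneStage α (r n) (m n) (γ n) := by
  have hle : unitInterval.toNNReal (γ n) ≤ 1 := (γ n).2.2
  have hρ0 : (r n : ℝ) ≠ 0 := by
    have : (1 : ℝ) ≤ r n := by exact_mod_cast hr n
    linarith
  have hmeas : Measurable fun y : ℝ≥0 => utility α ((y / r n : ℝ≥0) : ℝ) :=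
    (measurable_utility_coe α).comp (measurable_id.div_const _)
  rw [stage, hQ, integral_map (measurable_nextWealth _ _ _).aemeasurable
    hmeas.aestronglyMeasurable, oneStage]
  refine integral_congr_ae (Eventually.of_forall fun y => ?_)
  simp only
  push_cast
  rw [coe_nextWealth _ _ _ _ hle, unitInterval.coe_toNNReal]
  congr 1
  push_cast
  field_simp

theorem abs_stage_sub_le (hα0 : 0 < α) (hα1 : α < 1) (hr : ∀ n, 1 ≤ r n) {t : ℝ} (ht : 0 ≤ t)
    (h : transDist (holderClass ℝ≥0 α) (gauge α) Q Q' ≤ ENNReal.ofReal t) (γ : Fin N → I)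
    (n : Fin N) : |stage Q γ n - stage Q' γ n| ≤ 2 * t := by
  let d : (market α r).D n := ⟨(1, unitInterval.toNNReal (γ n)), zero_le, (γ n).2.2⟩
  have h1 : probDist (holderClass ℝ≥0 α) (Q.kernel n d) (Q'.kernel n d) /
      ENNReal.ofReal (gauge α d.1.1) ≤ ENNReal.ofReal t := by
    refine le_trans ?_ h
    unfold transDist
    exact le_iSup₂_of_le n d le_rfl
  have hg : gauge α d.1.1 = 2 := by simp [d, gauge, utility]; norm_num
  rw [hg, ENNReal.div_le_iff (by simp) ENNReal.ofReal_ne_top, ← ENNReal.ofReal_mul ht] at h1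
  have h2 : ENNReal.ofReal |stage Q γ n - stage Q' γ n| ≤
      probDist (holderClass ℝ≥0 α) (Q.kernel n d) (Q'.kernel n d) := by
    unfold probDist
    exact le_iSup₂_of_le (fun y : ℝ≥0 => utility α ((y / r n : ℝ≥0) : ℝ))
      (utility_div_mem_holderClass hα0 hα1 (hr n)) le_rfl
  have h3 := (ENNReal.ofReal_le_ofReal_iff (by positivity)).1 (h2.trans h1)
  linarith

theorem exists_abs_stage_le (hα0 : 0 < α) (hα1 : α < 1) (hr : ∀ n, 1 ≤ r n)
    (hm : ∀ n, m n ∈ returnLaws α) (hQ : IsGeneratedBy α r m Q) :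
    ∃ A, 1 ≤ A ∧ ∀ (γ : Fin N → I) n, |stage Q γ n| ≤ A := by
  obtain ⟨γ₀, hγ₀⟩ := exists_oneStage_max hα0 hα1 hr hm
  refine ⟨1 + ∑ n, oneStage α (r n) (m n) (γ₀ n),
    le_add_of_nonneg_right (Finset.sum_nonneg fun n _ => oneStage_nonneg _), fun γ n => ?_⟩
  rw [stage_eq_oneStage hr hQ, abs_of_nonneg (oneStage_nonneg _)]
  have := Finset.single_le_sum (f := fun n => oneStage α (r n) (m n) (γ₀ n))
    (fun n _ => oneStage_nonneg _) (Finset.mem_univ n)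
  linarith [hγ₀ n (γ n)]

/-- The return laws of the mixture `P + ε (Q - P)`. -/
noncomputable def mixLaws (mP mQ : Fin N → Measure ℝ≥0) (ε : I) (n : Fin N) : Measure ℝ≥0 :=
  ENNReal.ofReal (1 - (ε : ℝ)) • mP n + ENNReal.ofReal (ε : ℝ) • mQ n

theorem mixLaws_mem (hmP : ∀ n, mP n ∈ returnLaws α) (hm : ∀ n, m n ∈ returnLaws α) (ε : I)
    (n : Fin N) : mixLaws mP m ε n ∈ returnLaws α := by
  have := (hmP n).1
  have := (hm n).1
  refine ⟨⟨?_⟩, ((hmP n).2.smul_measure ENNReal.ofReal_ne_top).add_measure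
    ((hm n).2.smul_measure ENNReal.ofReal_ne_top)⟩
  simp only [mixLaws, Measure.add_apply, Measure.smul_apply, smul_eq_mul, measure_univ, mul_one]
  rw [← ENNReal.ofReal_add (by linarith [ε.2.2]) ε.2.1]
  simp

theorem isGeneratedBy_mix (hP : IsGeneratedBy α r mP P) (hQ : IsGeneratedBy α r m Q) (ε : I) :
    IsGeneratedBy α r (mixLaws mP m ε) (mix P Q ε) := by
  intro n d
  have hη := measurable_nextWealth (r n) d.1.1 d.1.2
  rw [mixLaws, Measure.map_add _ _ hη, Measure.map_smul, Measure.map_smul, ← hP, ← hQ]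
  rfl

theorem linearValue_eq_prod_stage (hr : ∀ n, 1 ≤ r n) (hQ : IsGeneratedBy α r m Q)
    (γ : Fin N → I) : linearValue α r m γ = ∏ n, stage Q γ n := by
  simp only [linearValue, stage_eq_oneStage hr hQ]

theorem linearValue_mixLaws (hα0 : 0 < α) (hα1 : α < 1) (hr : ∀ n, 1 ≤ r n)
    (hmP : ∀ n, mP n ∈ returnLaws α) (hP : IsGeneratedBy α r mP P)
    (hm : ∀ n, m n ∈ returnLaws α) (hQ : IsGeneratedBy α r m Q) (ε : I) (γ : Fin N → I) :
    linearValue α r (mixLaws mP m ε) γ =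
      ∏ n, ((1 - (ε : ℝ)) * stage P γ n + ε * stage Q γ n) := by
  refine Finset.prod_congr rfl fun n _ => ?_
  rw [stage_eq_oneStage hr hP, stage_eq_oneStage hr hQ]
  exact oneStage_mix hα0 hα1 (hr n) (hmP n) (hm n) ε.2.1 ε.2.2 _

/-! ### The derivative in a direction -/

/-- The derivative at `P` in direction `Q - P` of the value of `π_γ` at initial wealth one. -/
noncomputable def slope (P Q : Transition (market α r)) (γ : Fin N → I) : ℝ :=
  telescopicSum (stage P γ) (stage Q γ)

theorem exists_abs_slope_sub_le (hα0 : 0 < α) (hα1 : α < 1) (hr : ∀ n, 1 ≤ r n)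
    (hmP : ∀ n, mP n ∈ returnLaws α) (hP : IsGeneratedBy α r mP P) :
    ∃ C, 0 ≤ C ∧ ∀ (Q Q' : Transition (market α r)) (t : ℝ), 0 ≤ t →
      transDist (holderClass ℝ≥0 α) (gauge α) Q Q' ≤ ENNReal.ofReal t →
        ∀ γ, |slope P Q γ - slope P Q' γ| ≤ C * t := by
  obtain ⟨A, hA1, hA⟩ := exists_abs_stage_le hα0 hα1 hr hmP hP
  refine ⟨N * A ^ N * 2, by positivity, fun Q Q' t ht h γ => ?_⟩
  rw [mul_assoc]
  exact abs_telescopicSum_sub_le hA1 (hA γ) fun n => abs_stage_sub_le hα0 hα1 hr ht h γ n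

theorem continuous_slope (hα0 : 0 < α) (hα1 : α < 1) (hr : ∀ n, 1 ≤ r n)
    (hmP : ∀ n, mP n ∈ returnLaws α) (hP : IsGeneratedBy α r mP P)
    (hm : ∀ n, m n ∈ returnLaws α) (hQ : IsGeneratedBy α r m Q) : Continuous (slope P Q) := by
  have hc : ∀ {m : Fin N → Measure ℝ≥0} {Q : Transition (market α r)},
      (∀ n, m n ∈ returnLaws α) → IsGeneratedBy α r m Q →
        ∀ n, Continuous fun γ => stage Q γ n := fun hm hQ n => by
    simp only [stage_eq_oneStage hr hQ]
    exact (continuous_oneStage hα0 hα1 (hr n) (hm n)).comp (continuous_apply n)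
  unfold slope telescopicSum
  refine continuous_finsetSum _ fun k _ => continuous_finsetProd _ fun j _ => ?_
  split_ifs
  · exact (hc hm hQ j).sub (hc hmP hP j)
  · exact hc hmP hP j

/-- First order expansion of the value of `π_γ` at initial wealth one, uniformly in `γ` and in
`Q` from a ball of the Hölder metric. -/
theorem exists_abs_linearValue_sub_slope_le (hα0 : 0 < α) (hα1 : α < 1) (hr : ∀ n, 1 ≤ r n)
    (hmP : ∀ n, mP n ∈ returnLaws α) (hP : IsGeneratedBy α r mP P)
    (hQ' : Q' ∈ marketTransitions α r) {δ : ℝ} (hδ : 0 ≤ δ) :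
    ∃ C, 0 ≤ C ∧ ∀ (Q : Transition (market α r)) (m : Fin N → Measure ℝ≥0),
      (∀ n, m n ∈ returnLaws α) → IsGeneratedBy α r m Q →
        transDist (holderClass ℝ≥0 α) (gauge α) Q Q' ≤ ENNReal.ofReal δ →
          ∀ (ε : I) γ, |linearValue α r (mixLaws mP m ε) γ -
            (linearValue α r mP γ + ε * slope P Q γ)| ≤ C * (ε : ℝ) ^ 2 := by
  obtain ⟨m', hm', hQ'⟩ := hQ'
  obtain ⟨A, hA1, hA⟩ := exists_abs_stage_le hα0 hα1 hr hmP hP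
  obtain ⟨A', hA1', hA'⟩ := exists_abs_stage_le hα0 hα1 hr hm' hQ'
  obtain ⟨C, hC0, hC⟩ := exists_abs_prod_sub_telescopicSum_le N (A := A + A' + 2 * δ) (by linarith)
  refine ⟨C, hC0, fun Q m hm hQ hd ε γ => ?_⟩
  rw [linearValue_mixLaws hα0 hα1 hr hmP hP hm hQ, linearValue_eq_prod_stage hr hP, ← sub_sub]
  refine hC _ _ (fun n => (hA γ n).trans (by linarith)) (fun n => ?_) ε ε.2.1 ε.2.2
  have h1 := abs_stage_sub_le hα0 hα1 hr hδ hd γ n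
  have h2 := abs_sub_abs_le_abs_sub (stage Q γ n) (stage Q' γ n)
  linarith [hA' γ n]

end Stage

/-! ### Differentiability of the value functionals -/

section Derivative

theorem diff_injective {E A : Type*} [MeasurableSpace E] [MeasurableSpace A] {N : ℕ}
    {𝔐 : Model E A N} (P : Transition 𝔐) : Function.Injective fun Q => diff Q P := by
  intro Q Q' h
  refine Transition.ext (funext fun n => Kernel.ext fun d => ?_)
  have := Q.markov n
  have := Q'.markov n
  exact Measure.toSignedMeasure_eq_toSignedMeasure_iff.1
    (sub_left_injective (congrFun (congrFun h n) d))

/-- A function `F` of the transition function `Q`, viewed as a function of `Q - P`. As `Q - P`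
determines `Q`, this is well defined on the tangent space; the value `0` elsewhere is
irrelevant. -/
noncomputable def ofDiff {E A : Type*} [MeasurableSpace E] [MeasurableSpace A] {N : ℕ}
    {𝔐 : Model E A N} (P : Transition 𝔐) (F : Transition 𝔐 → ℝ) : SignedTransition 𝔐 → ℝ :=
  Function.extend (fun Q => diff Q P) F 0

theorem ofDiff_diff {E A : Type*} [MeasurableSpace E] [MeasurableSpace A] {N : ℕ}
    {𝔐 : Model E A N} (P : Transition 𝔐) (F : Transition 𝔐 → ℝ) (Q : Transition 𝔐) :
    ofDiff P F (diff Q P) = F Q :=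
  (diff_injective P).extend_apply F 0 Q

theorem isContinuousDirection_ofDiff {E A : Type*} [MeasurableSpace E] [MeasurableSpace A]
    {N : ℕ} {𝔐 : Model E A N} {T : Set (Transition 𝔐)} {M : Set (E → ℝ)} {φ : E → ℝ}
    {P : Transition 𝔐} {F : Transition 𝔐 → ℝ} {C : ℝ} (hC : 0 ≤ C)
    (h : ∀ Q ∈ T, ∀ Q' ∈ T, ∀ t : ℝ, 0 ≤ t → transDist M φ Q' Q ≤ ENNReal.ofReal t →
      |F Q' - F Q| ≤ C * t) : IsContinuousDirection T M φ P (ofDiff P F) := by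
  intro Q hQ ε hε
  refine ⟨Real.toNNReal (ε / (C + 1)), by simpa using by positivity, fun Q' hQ' hd => ?_⟩
  rw [ofDiff_diff, ofDiff_diff, Real.norm_eq_abs]
  refine (h Q hQ Q' hQ' (ε / (C + 1)) (by positivity) hd.le).trans_lt ?_
  rw [mul_div_assoc', div_lt_iff₀ (by positivity)]
  nlinarith

variable {N : ℕ} {α : ℝ} {r : Fin N → ℝ≥0} {m mP : Fin N → Measure ℝ≥0}
  {P Q Q' : Transition (market α r)}

theorem abs_inv_mul_sub_le {ε a b c t : ℝ} (hε : 0 < ε) (h : |a - (b + ε * c)| ≤ ε * t) :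
    |ε⁻¹ * (a - b) - c| ≤ t := by
  have e : ε⁻¹ * (a - b) - c = ε⁻¹ * (a - (b + ε * c)) := by field_simp; ring
  rw [e, abs_mul, abs_of_pos (inv_pos.2 hε), inv_mul_le_iff₀ hε]
  exact h

/-- The value of a linear strategy is differentiable uniformly on bounded sets. -/
theorem isFrechetDerivative_value (hα0 : 0 < α) (hα1 : α < 1) (hr : ∀ n, 1 ≤ r n)
    (hmP : ∀ n, mP n ∈ returnLaws α) (hP : IsGeneratedBy α r mP P) (x₀ : ℝ≥0)
    (γ : Fin N → I) :
    IsFrechetDerivative (marketTransitions α r) (holderClass ℝ≥0 α) (gauge α)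
      (value x₀ (linearStrategy α r γ)) P (ofDiff P fun Q => slope P Q γ * utility α x₀) := by
  have hu : 0 ≤ utility α x₀ := utility_nonneg x₀.2
  refine ⟨?_, ?_⟩
  · obtain ⟨C, hC0, hC⟩ := exists_abs_slope_sub_le hα0 hα1 hr hmP hP
    refine isContinuousDirection_ofDiff (C := C * utility α x₀) (by positivity)
      fun Q _ Q' _ t ht hd => ?_
    rw [← sub_mul, abs_mul, abs_of_nonneg hu, mul_right_comm]
    gcongr
    exact hC Q' Q t ht hd γ
  · rintro K ⟨hKT, P', hP', δ, hδ, hK⟩ ε hε hε0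
    obtain ⟨C, hC0, hC⟩ := exists_abs_linearValue_sub_slope_le hα0 hα1 hr hmP hP hP' hδ.le
    rw [Metric.tendstoUniformlyOn_iff]
    intro η hη
    have hlim : Tendsto (fun m => C * (ε m : ℝ) * utility α x₀) atTop (𝓝 0) := by
      have : Tendsto (fun m => (ε m : ℝ)) atTop (𝓝 0) :=
        (continuous_subtype_val.tendsto (0 : I)).comp hε0
      simpa using (this.const_mul C).mul_const (utility α x₀)
    filter_upwards [hlim.eventually_lt_const hη] with k hk Q hQ
    obtain ⟨m, hm, hQm⟩ := hKT hQ
    have hεk : (0 : ℝ) < ε k := hε k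
    have h := hC Q m hm hQm (hK Q hQ) (ε k) γ
    have h' := abs_inv_mul_sub_le hεk (t := C * ε k) (h.trans_eq (by ring))
    rw [dist_comm, Real.dist_eq, ofDiff_diff, smul_eq_mul,
      value_linearStrategy hα0 hα1 hr (mixLaws_mem hmP hm _) (isGeneratedBy_mix hP hQm _),
      value_linearStrategy hα0 hα1 hr hmP hP, ← sub_mul, ← mul_assoc, ← sub_mul, abs_mul,
      abs_of_nonneg hu]
    refine lt_of_le_of_lt ?_ hk
    gcongr
    exact h'

/-- The derivative at `P` in direction `Q - P` of the optimal value at initial wealth one. -/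
noncomputable def maxSlope (mP : Fin N → Measure ℝ≥0) (P Q : Transition (market α r)) : ℝ :=
  sSup (slope P Q '' maximizers (linearValue α r mP))

theorem exists_abs_maxSlope_sub_le (hα0 : 0 < α) (hα1 : α < 1) (hr : ∀ n, 1 ≤ r n)
    (hmP : ∀ n, mP n ∈ returnLaws α) (hP : IsGeneratedBy α r mP P) :
    ∃ C, 0 ≤ C ∧ ∀ Q ∈ marketTransitions α r, ∀ Q' ∈ marketTransitions α r, ∀ t : ℝ, 0 ≤ t →
      transDist (holderClass ℝ≥0 α) (gauge α) Q Q' ≤ ENNReal.ofReal t →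
        |maxSlope mP P Q - maxSlope mP P Q'| ≤ C * t := by
  obtain ⟨C, hC0, hC⟩ := exists_abs_slope_sub_le hα0 hα1 hr hmP hP
  refine ⟨C, hC0, ?_⟩
  rintro Q ⟨m, hm, hQ⟩ Q' ⟨m', hm', hQ'⟩ t ht hd
  exact abs_sSup_image_sub_le (maximizers_nonempty (continuous_linearValue hα0 hα1 hr hmP))
    (bddAbove_image_of_continuous (continuous_slope hα0 hα1 hr hmP hP hm hQ) _)
    (bddAbove_image_of_continuous (continuous_slope hα0 hα1 hr hmP hP hm' hQ') _)
    fun γ _ => hC Q Q' t ht hd γ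

/-- Near a fixed `Q'`, the difference quotient of the optimal value in direction `Q - P` is close
to the difference quotient of the maximum of the linearization in direction `Q' - P`. -/
theorem exists_abs_quotient_sub_le (hα0 : 0 < α) (hα1 : α < 1) (hr : ∀ n, 1 ≤ r n)
    (hmP : ∀ n, mP n ∈ returnLaws α) (hP : IsGeneratedBy α r mP P) (x₀ : ℝ≥0)
    (hQ' : Q' ∈ marketTransitions α r) :
    ∃ C, 0 ≤ C ∧ ∀ Q ∈ marketTransitions α r, ∀ t : ℝ, 0 ≤ t → t ≤ 1 →
      transDist (holderClass ℝ≥0 α) (gauge α) Q Q' ≤ ENNReal.ofReal t → ∀ ε : I, 0 < ε →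
        |(ε : ℝ)⁻¹ * (optimalValue x₀ (mix P Q ε) - optimalValue x₀ P) -
          (ε : ℝ)⁻¹ * (sSup ((fun γ => linearValue α r mP γ + ε * slope P Q' γ) '' Set.univ) -
            sSup (linearValue α r mP '' Set.univ)) * utility α x₀|
          ≤ C * (ε + t) := by
  have hu : 0 ≤ utility α x₀ := utility_nonneg x₀.2
  obtain ⟨C₁, hC₁0, hC₁⟩ :=
    exists_abs_linearValue_sub_slope_le hα0 hα1 hr hmP hP hQ' zero_le_one
  obtain ⟨C₂, hC₂0, hC₂⟩ := exists_abs_slope_sub_le hα0 hα1 hr hmP hP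
  obtain ⟨m', hm', hQ'⟩ := hQ'
  refine ⟨(C₁ + C₂) * utility α x₀, by positivity, ?_⟩
  rintro Q ⟨m, hm, hQ⟩ t ht ht1 hd ε hε
  have hε' : (0 : ℝ) < ε := hε
  have hmix := mixLaws_mem hmP hm ε
  have hcP := continuous_linearValue hα0 hα1 hr hmP
  have hs := continuous_slope hα0 hα1 hr hmP hP hm' hQ'
  have hsup : |sSup (linearValue α r (mixLaws mP m ε) '' Set.univ) -
      sSup ((fun γ => linearValue α r mP γ + ε * slope P Q' γ) '' Set.univ)|
        ≤ C₁ * (ε : ℝ) ^ 2 + ε * (C₂ * t) := by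
    refine abs_sSup_image_sub_le Set.univ_nonempty
      (bddAbove_image_of_continuous (continuous_linearValue hα0 hα1 hr hmix) _)
      (bddAbove_image_of_continuous (hcP.add (continuous_const.mul hs)) _) fun γ _ => ?_
    have h1 := hC₁ Q m hm hQ (hd.trans (ENNReal.ofReal_le_ofReal ht1)) ε γ
    have h2 := hC₂ Q Q' t ht hd γ
    have e : linearValue α r (mixLaws mP m ε) γ - (linearValue α r mP γ + ε * slope P Q' γ) =
        (linearValue α r (mixLaws mP m ε) γ - (linearValue α r mP γ + ε * slope P Q γ)) +
          ε * (slope P Q γ - slope P Q' γ) := by ring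
    rw [e]
    refine (abs_add_le _ _).trans (add_le_add h1 ?_)
    rw [abs_mul, abs_of_pos hε']
    gcongr
  rw [optimalValue_eq hα0 hα1 hr hmix (isGeneratedBy_mix hP hQ ε),
    optimalValue_eq hα0 hα1 hr hmP hP, ← sub_mul, ← mul_assoc, ← sub_mul, ← mul_sub,
    sub_sub_sub_cancel_right, abs_mul, abs_mul, abs_of_nonneg hu, abs_of_pos (inv_pos.2 hε'),
    mul_right_comm (C₁ + C₂)]
  refine mul_le_mul_of_nonneg_right ?_ hu
  rw [inv_mul_le_iff₀ hε']
  refine hsup.trans ?_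
  have h1 : 0 ≤ ε * (C₁ * t) := by positivity
  have h2 : 0 ≤ (ε : ℝ) * (C₂ * ε) := by positivity
  linarith

/-- The optimal value is differentiable uniformly on relatively compact sets: Danskin's theorem
gives the derivative in each single direction, and the difference quotients depend on the
direction in a uniformly Lipschitz continuous way. -/
theorem isHadamardDerivative_optimalValue (hα0 : 0 < α) (hα1 : α < 1) (hr : ∀ n, 1 ≤ r n)
    (hmP : ∀ n, mP n ∈ returnLaws α) (hP : IsGeneratedBy α r mP P) (x₀ : ℝ≥0) :
    IsHadamardDerivative (marketTransitions α r) (holderClass ℝ≥0 α) (gauge α)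
      (optimalValue x₀) P (ofDiff P fun Q => maxSlope mP P Q * utility α x₀) := by
  have hu : 0 ≤ utility α x₀ := utility_nonneg x₀.2
  obtain ⟨C₀, hC₀0, hC₀⟩ := exists_abs_maxSlope_sub_le hα0 hα1 hr hmP hP
  have hLip : ∀ Q ∈ marketTransitions α r, ∀ Q' ∈ marketTransitions α r, ∀ t : ℝ, 0 ≤ t →
      transDist (holderClass ℝ≥0 α) (gauge α) Q' Q ≤ ENNReal.ofReal t →
      |maxSlope mP P Q' * utility α x₀ - maxSlope mP P Q * utility α x₀|
        ≤ C₀ * utility α x₀ * t := fun Q hQ Q' hQ' t ht hd => by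
    rw [← sub_mul, abs_mul, abs_of_nonneg hu, mul_right_comm]
    gcongr
    exact hC₀ Q' hQ' Q hQ t ht hd
  refine ⟨isContinuousDirection_ofDiff (by positivity) hLip, ?_⟩
  rintro K ⟨hKT, hK⟩ ε hε hε0
  rw [Metric.tendstoUniformlyOn_iff]
  intro η hη
  by_contra hcon
  -- otherwise the error is at least `η` along a sequence of directions in `K`, which may be
  -- taken convergent
  obtain ⟨φ, hφ, hbad⟩ := extraction_of_frequently_atTop (not_eventually.1 hcon)
  push Not at hbad
  choose Q hQK hQη using hbad
  obtain ⟨s, hs, Q', hQ'T, hlim⟩ := hK Q hQK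
  obtain ⟨C, hC0, hC⟩ := exists_abs_quotient_sub_le hα0 hα1 hr hmP hP x₀ hQ'T
  have hsub : Tendsto (fun j => φ (s j)) atTop atTop := hφ.tendsto_atTop.comp hs.tendsto_atTop
  have hεr : Tendsto (fun j => (ε (φ (s j)) : ℝ)) atTop (𝓝 0) :=
    ((continuous_subtype_val.tendsto (0 : I)).comp hε0).comp hsub
  set t : ℕ → ℝ := fun j =>
    (transDist (holderClass ℝ≥0 α) (gauge α) (Q (s j)) Q').toReal
  have ht : Tendsto t atTop (𝓝 0) := by
    simpa [t, Function.comp_def] using (ENNReal.tendsto_toReal ENNReal.zero_ne_top).comp hlim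
  have hDanskin : Tendsto (fun j => (ε (φ (s j)) : ℝ)⁻¹ *
      (sSup ((fun γ => linearValue α r mP γ + ε (φ (s j)) * slope P Q' γ) '' Set.univ) -
        sSup (linearValue α r mP '' Set.univ)) * utility α x₀ - maxSlope mP P Q' * utility α x₀)
      atTop (𝓝 0) := by
    obtain ⟨m', hm', hQ'⟩ := hQ'T
    have := tendsto_sSup_image_quotient (continuous_linearValue hα0 hα1 hr hmP)
      (continuous_slope hα0 hα1 hr hmP hP hm' hQ') (ε := fun j => (ε (φ (s j)) : ℝ))
      (fun j => hε _) hεr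
    simpa [maxSlope] using (this.mul_const (utility α x₀)).sub_const
      (maxSlope mP P Q' * utility α x₀)
  have hbound : Tendsto (fun j => C * (ε (φ (s j)) + t j) +
      |(ε (φ (s j)) : ℝ)⁻¹ *
        (sSup ((fun γ => linearValue α r mP γ + ε (φ (s j)) * slope P Q' γ) '' Set.univ) -
          sSup (linearValue α r mP '' Set.univ)) * utility α x₀ -
            maxSlope mP P Q' * utility α x₀| + C₀ * utility α x₀ * t j) atTop (𝓝 0) := by
    simpa using (((hεr.add ht).const_mul C).add hDanskin.abs).add
      (ht.const_mul (C₀ * utility α x₀))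
  refine absurd (ge_of_tendsto hbound ?_) (not_le.2 hη)
  filter_upwards [hlim.eventually_lt_const ENNReal.zero_lt_top, ht.eventually_lt_const one_pos]
    with j hfin ht1
  have hd : transDist (holderClass ℝ≥0 α) (gauge α) (Q (s j)) Q' ≤ ENNReal.ofReal (t j) :=
    (ENNReal.ofReal_toReal hfin.ne).ge
  have ht0 : 0 ≤ t j := ENNReal.toReal_nonneg
  have hQj := hKT (hQK (s j))
  have h1 := hC (Q (s j)) hQj (t j) ht0 ht1.le hd (ε (φ (s j))) (hε _)
  have h2 := hLip Q' hQ'T (Q (s j)) hQj (t j) ht0 hd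
  have h3 := hQη (s j)
  rw [dist_comm, Real.dist_eq, ofDiff_diff, smul_eq_mul] at h3
  refine h3.trans ((abs_sub_le _ _ _).trans
    (add_le_add ((abs_sub_le _ _ _).trans (add_le_add h1 le_rfl)) ?_))
  rw [abs_sub_comm]
  exact h2

end Derivative

end MDM

theorem theorem3 {N : ℕ} (α : ℝ) (hα0 : 0 < α) (hα1 : α < 1)
    (r : Fin N → ℝ≥0) (hr : ∀ n, 1 ≤ r n)
    (P : MDM.Transition (MDM.market α r)) (mP : Fin N → Measure ℝ≥0)
    (hmP : ∀ n, mP n ∈ MDM.returnLaws α) (hP : MDM.IsGeneratedBy α r mP P) (x₀ : ℝ≥0) :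
    -- expected total rewards and the value functional are well defined on all of `𝒫_ψ`
    (∀ Q ∈ MDM.marketTransitions α r,
      (∀ π : MDM.Strategy (MDM.market α r),
        Integrable (MDM.totalReward π) (MDM.law Q π x₀)) ∧
      BddAbove (Set.range fun π : MDM.Strategy (MDM.market α r) => MDM.value x₀ π Q)) ∧
    ∃ DV : (Fin N → I) → MDM.SignedTransition (MDM.market α r) → ℝ,
      -- (i)
      (∀ γ : Fin N → I,
        MDM.IsFrechetDerivative (MDM.marketTransitions α r) (MDM.holderClass ℝ≥0 α)
          (MDM.gauge α) (MDM.value x₀ (MDM.linearStrategy α r γ)) P (DV γ) ∧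
        ∀ (Q : MDM.Transition (MDM.market α r)) (mQ : Fin N → Measure ℝ≥0),
          (∀ n, mQ n ∈ MDM.returnLaws α) → MDM.IsGeneratedBy α r mQ Q →
          DV γ (MDM.diff Q P) =
            MDM.telescopicSum (fun n => MDM.oneStage α (r n) (mP n) (γ n))
              (fun n => MDM.oneStage α (r n) (mQ n) (γ n)) * MDM.utility α x₀) ∧
      -- (ii)
      ∃ DVopt : MDM.SignedTransition (MDM.market α r) → ℝ,
        MDM.IsHadamardDerivative (MDM.marketTransitions α r) (MDM.holderClass ℝ≥0 α)
          (MDM.gauge α) (MDM.optimalValue x₀) P DVopt ∧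
        (∀ Q ∈ MDM.marketTransitions α r,
          IsLUB {w : ℝ | ∃ γ : Fin N → I,
            MDM.IsOptimal P (MDM.linearStrategy α r γ) ∧ w = DV γ (MDM.diff Q P)}
            (DVopt (MDM.diff Q P))) ∧
        -- if no return law of `P` is the point mass at the bond return, then the one-stage
        -- problems have unique solutions, which determine the derivative
        ((∀ n, mP n ≠ Measure.dirac (r n)) →
          ∃ γP : Fin N → I,
            (∀ (n : Fin N) (γ : I), γ ≠ γP n →
              MDM.oneStage α (r n) (mP n) γ < MDM.oneStage α (r n) (mP n) (γP n)) ∧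
            ∀ Q ∈ MDM.marketTransitions α r,
              DVopt (MDM.diff Q P) = DV γP (MDM.diff Q P)) := by
  refine ⟨?_, fun γ => MDM.ofDiff P fun Q => MDM.slope P Q γ * MDM.utility α x₀,
    fun γ => ⟨MDM.isFrechetDerivative_value hα0 hα1 hr hmP hP x₀ γ, fun Q mQ _ hQ => ?_⟩,
    MDM.ofDiff P fun Q => MDM.maxSlope mP P Q * MDM.utility α x₀,
    MDM.isHadamardDerivative_optimalValue hα0 hα1 hr hmP hP x₀, ?_, fun hne => ?_⟩
  · rintro Q ⟨m, hm, hQ⟩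
    exact ⟨MDM.integrable_totalReward hα0 hα1 hr hm hQ x₀,
      MDM.bddAbove_value hα0 hα1 hr hm hQ x₀⟩
  · beta_reduce
    rw [MDM.ofDiff_diff, MDM.slope]
    congr 2 <;> funext n
    · exact MDM.stage_eq_oneStage hr hP γ n
    · exact MDM.stage_eq_oneStage hr hQ γ n
  · rintro Q ⟨m, hm, hQ⟩
    simp only [MDM.ofDiff_diff, MDM.isOptimal_linearStrategy_iff hα0 hα1 hr hmP hP]
    have hlub : IsLUB (MDM.slope P Q '' MDM.maximizers (MDM.linearValue α r mP))
        (MDM.maxSlope mP P Q) :=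
      isLUB_csSup
        ((MDM.maximizers_nonempty (MDM.continuous_linearValue hα0 hα1 hr hmP)).image _)
        (MDM.bddAbove_image_of_continuous (MDM.continuous_slope hα0 hα1 hr hmP hP hm hQ) _)
    have h := hlub.mul_right (MDM.utility_nonneg (α := α) x₀.coe_nonneg)
    rw [Set.image_image] at h
    have hset : {w : ℝ | ∃ γ ∈ MDM.maximizers (MDM.linearValue α r mP),
        w = MDM.slope P Q γ * MDM.utility α x₀} =
        (fun γ => MDM.slope P Q γ * MDM.utility α x₀) ''
          MDM.maximizers (MDM.linearValue α r mP) := by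
      ext w
      simp [eq_comm]
    rw [← hset] at h
    simpa only [exists_prop] using h
  · choose γP hγP using fun n => MDM.exists_unique_max_oneStage hα0 hα1 (hr n) (hmP n) (hne n)
    refine ⟨γP, hγP, fun Q _ => ?_⟩
    beta_reduce
    rw [MDM.ofDiff_diff, MDM.ofDiff_diff, MDM.maxSlope,
      MDM.maximizers_linearValue_eq_singleton hmP hγP, Set.image_singleton, csSup_singleton]
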